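/- **Setting.** Let $\alpha>1$, $\tau>\max\{3,\frac{\alpha}{\alpha-1}\}$, $p\ge 1$, $0<\theta<1$, and put $\beta=p(1-\theta)$. Let $(Z,d,\nu)$ be a complete metric space with a Borel measure $\nu$ such that $0<\nu(B)<\infty$ for every ball $B$ and $\nu(B(z,2r))\le C_\nu\,\nu(B(z,r))$ for all $z\in Z$, $r>0$. *Hyperbolic filling.* For each $n\in\mathbb Z$ let $S_n$ be a maximal $\alpha^{-n}$-separated subset of $Z$. The vertices are the pairs $v=(z,n)$ with $z\in S_n$; put $h(v)=n$, $\pi(v)=z$, $B(v)=B(z,\tau\alpha^{-n})$. Distinct vertices $v,w$ are joined by an edge ($v\sim w$) if $|h(v)-h(w)|\le 1$ and $B(v)\cap B(w)\ne\emptyset$. Let $X$ be the resulting metric graph, with its length metric in which all edges have length $1$, and extend $h$ linearly to the edges. Let $\rho=\alpha^{-h}$, let $d_\rho(x,y)=\inf_\gamma\int_\gamma\rho\,ds$ over rectifiable curves $\gamma$ in $X$ joining $x$ to $y$, let $X_\rho=(X,d_\rho)$ and let $\bar X_\rho$ be its completion. Each $z\in Z$ is identified with the point of $\partial X_\rho=\bar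 X_\rho\setminus X_\rho$ that is the limit of any sequence of vertices $v_n$ with $h(v_n)=n$ and $d(\pi(v_n),z)<\alpha^{-n}$, $n=0,1,2,\dots$. *Measure.* With $\mathcal L$ the Lebesgue measure on the edges of $X$, let $\mu(A)=\sum_{v}\sum_{w\sim v}(\nu(B(v))+\nu(B(w)))\,\mathcal L(A\cap vw)$ and $d\mu_\beta=\alpha^{-\beta h}\,d\mu$ on $X_\rho$, extended to $\bar X_\rho$ by $\mu_\beta(\partial X_\rho)=0$. *Hyperbolic upper gradients.* Let $f:Z\to[-\infty,\infty]$ be $\nu$-measurable. A Borel function $g:\bar X_\rho\to[0,\infty]$ is a hyperbolic upper gradient of $f$ if there is $G\subset Z$ with $\nu(Z\setminus G)=0$ such that for all $x,y\in G$ and every nonconstant compact rectifiable curve $\gamma$ in $\bar X_\rho$ joining $x$ to $y$, $$|f(x)-f(y)|\le\int_\gamma g\,ds,$$ where the left side is read as $\infty$ if $f(x)$ or $f(y)$ is infinite. *Besov space.* Put $$\|f\|_{B^\theta_p(Z)}^p=\int_Z\int_Z\frac{|f(x)-f(y)|^p}{d(x,y)^{p\theta}}\,\frac{d\nu(x)\,d\nu(y)}{\nu(B(x,d(x,y)))},$$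 and let $\widetilde B^\theta_p(Z)$ be the set of $\nu$-measurable $f$ that are $p$-integrable on every ball and satisfy $\|f\|_{B^\theta_p(Z)}<\infty$. **Proposition.** There is a constant $C$ depending only on $\alpha,\tau,C_\nu,p,\theta$ such that, if $f$ admits a hyperbolic upper gradient $g$ on $\bar X_\rho$ with $\int_{\bar X_\rho}g^p\,d\mu_\beta<\infty$, then $f\in\widetilde B^\theta_p(Z)$ and $$\|f\|_{B^\theta_p(Z)}\le C\,\|g\|_{L^p(X_\rho,\mu_\beta)}.$$ The same holds, with $C$ depending on the same parameters, when the metric $d$ is replaced in the definition of $\widetilde B^\theta_p(Z)$ and its norm (including the balls used there) by the metric which $d_\rho$ induces on $Z$ through the identification $Z=\partial X_\rho$. -/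

import Mathlib

open Set Filter Topology MeasureTheory
open scoped ENNReal NNReal unitInterval

noncomputable section

/-! ### Rectifiable curves and line integrals -/

/-- A compact rectifiable curve from `x` to `y`, given by its arc-length parametrization on
`[0, length]` (every compact rectifiable curve has one, and line integrals are defined through it).
The values of `toFun` outside `[0, length]` are irrelevant. -/
structure RectifiableCurve {Y : Type*} [PseudoEMetricSpace Y] (x y : Y) where
  length : ℝ≥0
  toFun : ℝ → Y
  unitSpeed : HasUnitSpeedOn toFun (Icc 0 (length : ℝ))
  source : toFun 0 = x
  target : toFun length = y

namespace RectifiableCurve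

variable {Y : Type*} [PseudoEMetricSpace Y] {x y z : Y}

/-- The line integral `∫_γ g ds`. -/
def lineIntegral (γ : RectifiableCurve x y) (g : Y → ℝ≥0∞) : ℝ≥0∞ :=
  ∫⁻ s in Icc (0 : ℝ) γ.length, g (γ.toFun s)

def refl (x : Y) : RectifiableCurve x x where
  length := 0
  toFun _ := x
  unitSpeed := hasConstantSpeedOnWith_of_subsingleton _ (by simp) _
  source := rfl
  target := rfl

def symm (γ : RectifiableCurve x y) : RectifiableCurve y x where
  length := γ.length
  toFun s := γ.toFun (γ.length - s)
  unitSpeed := by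
    intro a ha b hb
    have hanti : AntitoneOn (fun s : ℝ => (γ.length : ℝ) - s)
        (Icc (0 : ℝ) γ.length ∩ Icc a b) := by
      intro s _ t _ hst
      dsimp only
      linarith
    have key := eVariationOn.comp_eq_of_antitoneOn γ.toFun _ hanti
    have himg : (fun s : ℝ => (γ.length : ℝ) - s) '' (Icc (0 : ℝ) γ.length ∩ Icc a b)
        = Icc (0 : ℝ) γ.length ∩ Icc (γ.length - b) (γ.length - a) := by
      ext t
      simp only [mem_image, mem_inter_iff, mem_Icc]
      constructor
      · rintro ⟨s, ⟨⟨h1, h2⟩, h3, h4⟩, rfl⟩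
        refine ⟨⟨?_, ?_⟩, ?_, ?_⟩ <;> linarith
      · rintro ⟨⟨h1, h2⟩, h3, h4⟩
        refine ⟨γ.length - t, ⟨⟨?_, ?_⟩, ?_, ?_⟩, ?_⟩ <;> linarith
    rw [himg] at key
    have hb' : (γ.length : ℝ) - b ∈ Icc (0 : ℝ) γ.length := by
      constructor <;> linarith [hb.1, hb.2]
    have ha' : (γ.length : ℝ) - a ∈ Icc (0 : ℝ) γ.length := by
      constructor <;> linarith [ha.1, ha.2]
    have h2 := γ.unitSpeed hb' ha'
    rw [show (fun s => γ.toFun ((γ.length : ℝ) - s))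
      = γ.toFun ∘ (fun s : ℝ => (γ.length : ℝ) - s) from rfl, key, h2]
    congr 1
    simp
  source := by simpa using γ.target
  target := by simpa using γ.source

lemma lineIntegral_symm (γ : RectifiableCurve x y) (g : Y → ℝ≥0∞) :
    γ.symm.lineIntegral g = γ.lineIntegral g := by
  unfold lineIntegral
  have h := (Measure.measurePreserving_sub_left volume (γ.length : ℝ)).setLIntegral_comp_preimage_emb
    (Homeomorph.subLeft (γ.length : ℝ)).measurableEmbedding
    (fun s => g (γ.toFun s)) (Icc (0 : ℝ) γ.length)
  rw [← h]
  have : (fun x => (γ.length : ℝ) - x) ⁻¹' (Icc (0 : ℝ) γ.length) = Icc (0 : ℝ) γ.length := by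
    ext t
    simp only [mem_preimage, mem_Icc]
    constructor <;> rintro ⟨h1, h2⟩ <;> constructor <;> linarith
  rw [this]
  rfl

def trans (γ : RectifiableCurve x y) (η : RectifiableCurve y z) : RectifiableCurve x z where
  length := γ.length + η.length
  toFun s := if s ≤ γ.length then γ.toFun s else η.toFun (s - γ.length)
  unitSpeed := by
    have h1 : HasUnitSpeedOn
        (fun s : ℝ => if s ≤ γ.length then γ.toFun s else η.toFun (s - γ.length))
        (Icc 0 (γ.length : ℝ)) := by
      intro a ha b hb
      rw [← γ.unitSpeed ha hb]
      refine eVariationOn.congr ?_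
      intro s hs
      exact if_pos hs.1.2
    have h2 : HasUnitSpeedOn
        (fun s : ℝ => if s ≤ γ.length then γ.toFun s else η.toFun (s - γ.length))
        (Icc (γ.length : ℝ) ((γ.length : ℝ) + η.length)) := by
      intro a ha b hb
      have hmono : MonotoneOn (fun s : ℝ => s - (γ.length : ℝ))
          (Icc (γ.length : ℝ) ((γ.length : ℝ) + η.length) ∩ Icc a b) := by
        intro s _ t _ hst
        dsimp only
        linarith
      have himg : (fun s : ℝ => s - (γ.length : ℝ)) ''
          (Icc (γ.length : ℝ) ((γ.length : ℝ) + η.length) ∩ Icc a b)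
          = Icc (0 : ℝ) η.length ∩ Icc (a - γ.length) (b - γ.length) := by
        ext t
        simp only [mem_image, mem_inter_iff, mem_Icc]
        constructor
        · rintro ⟨s, ⟨⟨h1, h2⟩, h3, h4⟩, rfl⟩
          refine ⟨⟨?_, ?_⟩, ?_, ?_⟩ <;> linarith
        · rintro ⟨⟨h1, h2⟩, h3, h4⟩
          refine ⟨t + γ.length, ⟨⟨?_, ?_⟩, ?_, ?_⟩, ?_⟩ <;> linarith
      have key := eVariationOn.comp_eq_of_monotoneOn η.toFun _ hmono
      have ha' : a - (γ.length : ℝ) ∈ Icc (0 : ℝ) η.length := by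
        constructor <;> linarith [ha.1, ha.2]
      have hb' : b - (γ.length : ℝ) ∈ Icc (0 : ℝ) η.length := by
        constructor <;> linarith [hb.1, hb.2]
      rw [himg, η.unitSpeed ha' hb'] at key
      rw [show ((1 : ℝ≥0) : ℝ) * (b - a)
        = ((1 : ℝ≥0) : ℝ) * (b - γ.length - (a - γ.length)) by ring, ← key]
      refine eVariationOn.congr ?_
      intro s hs
      dsimp only [Function.comp]
      split_ifs with h
      · have : s = γ.length := le_antisymm h hs.1.1
        rw [this, sub_self, γ.target, η.source]
      · rfl
    have := HasUnitSpeedOn.Icc_Icc h1 h2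
    simpa using this
  source := by simp [γ.source]
  target := by
    split_ifs with h
    · have h0 : (η.length : ℝ) = 0 := by
        have := η.length.coe_nonneg
        push_cast at h
        linarith
      have h1 := η.target
      rw [h0, η.source] at h1
      push_cast
      rw [h0, add_zero, γ.target, h1]
    · push_cast
      rw [add_sub_cancel_left, η.target]

lemma lineIntegral_trans_le (γ : RectifiableCurve x y) (η : RectifiableCurve y z)
    (g : Y → ℝ≥0∞) :
    (γ.trans η).lineIntegral g ≤ γ.lineIntegral g + η.lineIntegral g := by
  unfold lineIntegral
  have hun : Icc (0 : ℝ) (γ.trans η).length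
      ⊆ Icc (0 : ℝ) γ.length ∪ Ioc (γ.length : ℝ) ((γ.length : ℝ) + η.length) := by
    intro s hs
    have h2 : s ≤ (γ.length : ℝ) + η.length := hs.2
    rcases le_or_gt s γ.length with h | h
    · exact Or.inl ⟨hs.1, h⟩
    · exact Or.inr ⟨h, h2⟩
  refine (lintegral_mono_set hun).trans ((lintegral_union_le _ _ _).trans ?_)
  refine add_le_add (le_of_eq ?_) ?_
  · refine setLIntegral_congr_fun measurableSet_Icc ?_
    intro s hs
    dsimp only [trans]
    rw [if_pos hs.2]
  · have h := (measurePreserving_sub_right volume (γ.length : ℝ)).setLIntegral_comp_preimage_emb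
      (Homeomorph.subRight (γ.length : ℝ)).measurableEmbedding
      (fun s => g (η.toFun s)) (Icc (0 : ℝ) η.length)
    rw [← h]
    calc _ = ∫⁻ s in Ioc (γ.length : ℝ) ((γ.length : ℝ) + η.length),
          g (η.toFun (s - γ.length)) := by
          refine setLIntegral_congr_fun measurableSet_Ioc ?_
          intro s hs
          dsimp only [trans]
          rw [if_neg (not_le.2 hs.1)]
      _ ≤ _ := by
          refine lintegral_mono_set ?_
          intro s hs
          simp only [mem_preimage, mem_Icc]
          constructor <;> linarith [hs.1, hs.2]

end RectifiableCurve

/-! ### The hyperbolic filling of a metric space -/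

/-- `S` is a maximal `r`-separated subset of `Z`. -/
def IsMaximalSeparated {Z : Type*} [MetricSpace Z] (r : ℝ) (S : Set Z) : Prop :=
  Maximal (fun T : Set Z => T.Pairwise fun x y => r ≤ dist x y) S

/-- The choices made in constructing a hyperbolic filling of `Z` with parameters `α`, `τ`:
a maximal `α⁻ⁿ`-separated subset of `Z` for each `n : ℤ`. -/
structure HyperbolicFilling (Z : Type*) [MetricSpace Z] (α τ : ℝ) where
  one_lt : 1 < α
  lt_tau : max 3 (α / (α - 1)) < τ
  net : ℤ → Set Z
  net_maximal : ∀ n : ℤ, IsMaximalSeparated (α ^ (-n)) (net n)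

namespace HyperbolicFilling

variable {Z : Type*} [MetricSpace Z] {α τ : ℝ} (F : HyperbolicFilling Z α τ)

/-- The vertices `(z, n)` with `z` in the `n`-th net. -/
def Vertex : Type _ := {v : Z × ℤ // v.1 ∈ F.net v.2}

variable {F} in
/-- The projection `π(z, n) = z`. -/
def Vertex.proj (v : F.Vertex) : Z := v.1.1

variable {F} in
/-- The height `h(z, n) = n`. -/
def Vertex.height (v : F.Vertex) : ℤ := v.1.2

variable {F} in
/-- The dilated ball `B(v)`. -/
def Vertex.ball (v : F.Vertex) : Set Z := Metric.ball v.proj (τ * α ^ (-v.height))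

/-- The graph on the vertices: distinct `v`, `w` are joined by an edge when their heights differ by
at most `1` and the balls `B(v)`, `B(w)` meet. -/
def graph : SimpleGraph F.Vertex where
  Adj v w := v ≠ w ∧ |v.height - w.height| ≤ 1 ∧ (v.ball ∩ w.ball).Nonempty
  symm := ⟨fun v w h => ⟨h.1.symm, by rw [abs_sub_comm]; exact h.2.1,
    by rw [inter_comm]; exact h.2.2⟩⟩
  loopless := ⟨fun _ h => h.1 rfl⟩

/-- Barycentric coordinates of the point at parameter `t` on the segment from `v` to `w`. -/
def coords (v w : F.Vertex) (t : ℝ) : F.Vertex →₀ ℝ :=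
  Finsupp.single v (1 - t) + Finsupp.single w t

/-- The metric graph `X` as a set: the geometric realization of the graph, a point being
given by its barycentric coordinates (the case `v = w` gives the vertices). -/
def Point : Type _ :=
  {x : F.Vertex →₀ ℝ // ∃ v w, (v = w ∨ F.graph.Adj v w) ∧ ∃ t : I, x = F.coords v w t}

/-- A vertex as a point of `X`. -/
def vertexPoint (v : F.Vertex) : F.Point :=
  ⟨F.coords v v 0, v, v, Or.inl rfl, 0, rfl⟩

variable {F} in
/-- The parametrization of the edge `vw` by `[0, 1]`, starting at `v`. -/
def edgePoint {v w : F.Vertex} (hvw : F.graph.Adj v w) (t : I) : F.Point :=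
  ⟨F.coords v w t, v, w, Or.inr hvw, t, rfl⟩

/-- The height function, extended linearly to the edges. -/
def height (x : F.Point) : ℝ := x.1.sum fun v a => a * (v.height : ℝ)

/-- The distance of `x` and `y` along an edge containing both (`∞` if there is none). -/
def segLength (x y : F.Point) : ℝ≥0∞ :=
  ⨅ (v : F.Vertex) (w : F.Vertex) (hvw : F.graph.Adj v w) (s : I) (t : I)
    (_ : x = edgePoint hvw s) (_ : y = edgePoint hvw t), ENNReal.ofReal |(s : ℝ) - t|

/-- The length metric of the graph in which all edges have unit length: the infimum of the lengths
of strings `c 0, …, c n` of points with any two consecutive ones on a common edge. -/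
def graphEDist (x y : F.Point) : ℝ≥0∞ :=
  ⨅ (n : ℕ) (c : ℕ → F.Point) (_ : c 0 = x) (_ : c n = y),
    ∑ i ∈ Finset.range n, F.segLength (c i) (c (i + 1))

variable {F} in
lemma segLength_comm (x y : F.Point) : F.segLength x y = F.segLength y x := by
  have key : ∀ x y : F.Point, F.segLength x y ≤ F.segLength y x := by
    intro x y
    refine le_iInf fun v => le_iInf fun w => le_iInf fun hvw => le_iInf fun s => le_iInf fun t =>
      le_iInf fun hs => le_iInf fun ht => ?_
    rw [abs_sub_comm]
    exact iInf_le_of_le v <| iInf_le_of_le w <| iInf_le_of_le hvw <| iInf_le_of_le t <|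
      iInf_le_of_le s <| iInf_le_of_le ht <| iInf_le_of_le hs le_rfl
  exact le_antisymm (key x y) (key y x)

variable {F} in
lemma graphEDist_le_string (n : ℕ) (c : ℕ → F.Point) :
    F.graphEDist (c 0) (c n) ≤ ∑ i ∈ Finset.range n, F.segLength (c i) (c (i + 1)) :=
  iInf_le_of_le n <| iInf_le_of_le c <| iInf_le_of_le rfl <| iInf_le_of_le rfl le_rfl

instance : PseudoEMetricSpace F.Point where
  edist := F.graphEDist
  edist_self x := le_antisymm (by simpa using graphEDist_le_string 0 (fun _ => x)) zero_le
  edist_comm := by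
    have key : ∀ x y : F.Point, F.graphEDist x y ≤ F.graphEDist y x := by
      intro x y
      refine le_iInf fun n => le_iInf fun c => le_iInf fun h0 => le_iInf fun hn => ?_
      have := graphEDist_le_string n (fun i => c (n - i))
      simp only [Nat.sub_zero, Nat.sub_self] at this
      rw [h0, hn] at this
      refine this.trans (le_of_eq ?_)
      rw [← Finset.sum_range_reflect]
      refine Finset.sum_congr rfl fun i hi => ?_
      have hi := Finset.mem_range.1 hi
      rw [segLength_comm]
      congr 2 <;> omega
    exact fun x y => le_antisymm (key x y) (key y x)
  edist_triangle x y z := by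
    refine ENNReal.le_of_forall_pos_le_add ?_
    intro ε hε hfin
    have hε' : (0 : ℝ≥0∞) < (ε / 2 : ℝ≥0) := by exact_mod_cast half_pos hε
    have h1 : F.graphEDist x y < F.graphEDist x y + (ε / 2 : ℝ≥0) :=
      ENNReal.lt_add_right (ne_of_lt (lt_of_le_of_lt le_self_add hfin)) hε'.ne'
    have h2 : F.graphEDist y z < F.graphEDist y z + (ε / 2 : ℝ≥0) :=
      ENNReal.lt_add_right (ne_of_lt (lt_of_le_of_lt le_add_self hfin)) hε'.ne'
    conv_lhs at h1 => unfold graphEDist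
    conv_lhs at h2 => unfold graphEDist
    simp only [iInf_lt_iff] at h1 h2
    obtain ⟨n, c, hc0, hcn, h1⟩ := h1
    obtain ⟨m, d, hd0, hdm, h2⟩ := h2
    let e : ℕ → F.Point := fun i => if i ≤ n then c i else d (i - n)
    have he : ∀ j, e (n + j) = d j := by
      intro j
      rcases Nat.eq_zero_or_pos j with rfl | hj
      · simp [e, hcn, hd0]
      · have : ¬ n + j ≤ n := by omega
        simp [e, this]
    have := graphEDist_le_string (n + m) e
    rw [Finset.sum_range_add, he, show e 0 = x by simp [e, hc0], hdm] at this
    have e1 : ∑ i ∈ Finset.range n, F.segLength (e i) (e (i + 1))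
        = ∑ i ∈ Finset.range n, F.segLength (c i) (c (i + 1)) := by
      refine Finset.sum_congr rfl fun i hi => ?_
      have hi := Finset.mem_range.1 hi
      simp [e, hi.le, Nat.succ_le_of_lt hi]
    have e2 : ∑ i ∈ Finset.range m, F.segLength (e (n + i)) (e (n + i + 1))
        = ∑ i ∈ Finset.range m, F.segLength (d i) (d (i + 1)) := by
      refine Finset.sum_congr rfl fun i _ => ?_
      rw [he, add_assoc, he]
    rw [e1, e2] at this
    refine this.trans ((add_le_add h1.le h2.le).trans (le_of_eq ?_))
    have : ((ε : ℝ≥0) : ℝ≥0∞) = (ε / 2 : ℝ≥0) + (ε / 2 : ℝ≥0) := by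
      rw [← ENNReal.coe_add, add_halves]
    rw [this]
    ring

instance : MeasurableSpace F.Point := borel F.Point

instance : BorelSpace F.Point := ⟨rfl⟩

/-! ### Edges are unit-speed curves, and `X` is connected -/

variable {F}

lemma coords_lipschitz {v w : F.Vertex} (hvw : F.graph.Adj v w) (u : F.Vertex) (s t : ℝ) :
    |F.coords v w s u - F.coords v w t u| ≤ |s - t| := by
  classical
  have hne : v ≠ w := hvw.1
  simp only [coords, Finsupp.add_apply, Finsupp.single_apply]
  by_cases h1 : v = u
  · have h2 : ¬ w = u := fun h => hne (h1.trans h.symm)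
    rw [if_pos h1, if_neg h2, if_pos h1, if_neg h2, abs_sub_comm]
    exact le_of_eq (congrArg _ (by ring))
  · rw [if_neg h1, if_neg h1]
    by_cases h2 : w = u
    · simp [h2]
    · simp [h2]

/-- Each barycentric coordinate is `1`-Lipschitz. -/
lemma coord_le_edist (u : F.Vertex) (x y : F.Point) :
    ENNReal.ofReal |x.1 u - y.1 u| ≤ edist x y := by
  change _ ≤ F.graphEDist x y
  refine le_iInf fun n => le_iInf fun c => le_iInf fun h0 => le_iInf fun hn => ?_
  subst h0 hn
  have hstep : ∀ a b : F.Point, ENNReal.ofReal |a.1 u - b.1 u| ≤ F.segLength a b := by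
    intro a b
    refine le_iInf fun v => le_iInf fun w => le_iInf fun hvw => le_iInf fun s => le_iInf fun t =>
      le_iInf fun hs => le_iInf fun ht => ?_
    subst hs ht
    exact ENNReal.ofReal_le_ofReal (coords_lipschitz hvw u s t)
  induction n with
  | zero => simp
  | succ n ih =>
    rw [Finset.sum_range_succ]
    refine le_trans ?_ (add_le_add ih (hstep _ _))
    rw [← ENNReal.ofReal_add (abs_nonneg _) (abs_nonneg _)]
    exact ENNReal.ofReal_le_ofReal (abs_sub_le _ _ _)

lemma edist_edgePoint {v w : F.Vertex} (hvw : F.graph.Adj v w) (s t : I) :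
    edist (edgePoint hvw s) (edgePoint hvw t) = ENNReal.ofReal |(s : ℝ) - t| := by
  refine le_antisymm ?_ ?_
  · have h := graphEDist_le_string 1
      (fun i : ℕ => if i = 0 then edgePoint hvw s else edgePoint hvw t)
    simp only [Finset.range_one, Finset.sum_singleton, if_true, zero_add, one_ne_zero,
      if_false] at h
    refine h.trans ?_
    exact iInf_le_of_le v <| iInf_le_of_le w <| iInf_le_of_le hvw <| iInf_le_of_le s <|
      iInf_le_of_le t <| iInf_le_of_le rfl <| iInf_le_of_le rfl le_rfl
  · have h := coord_le_edist w (edgePoint hvw s) (edgePoint hvw t)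
    have hne : v ≠ w := hvw.1
    simpa [edgePoint, coords, hne] using h

lemma continuous_edgePoint {v w : F.Vertex} (hvw : F.graph.Adj v w) :
    Continuous (edgePoint hvw) := by
  have : LipschitzWith 1 (edgePoint hvw) := by
    intro s t
    rw [edist_edgePoint, ENNReal.coe_one, one_mul, edist_dist]
    rfl
  exact this.continuous

/-- The part of an edge between the parameters `s ≤ t`, as a curve. -/
def edgeCurve {v w : F.Vertex} (hvw : F.graph.Adj v w) (s t : I) (hst : s ≤ t) :
    RectifiableCurve (edgePoint hvw s) (edgePoint hvw t) where
  length := Real.toNNReal ((t : ℝ) - s)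
  toFun r := edgePoint hvw (projIcc 0 1 zero_le_one ((s : ℝ) + r))
  unitSpeed := by
    have hst' : (s : ℝ) ≤ t := hst
    rw [Real.coe_toNNReal _ (sub_nonneg.2 hst')]
    have hmem : ∀ r ∈ Icc (0 : ℝ) ((t : ℝ) - s), (s : ℝ) + r ∈ Icc (0 : ℝ) 1 := by
      intro r hr
      constructor <;> linarith [hr.1, hr.2, s.2.1, t.2.2]
    have hiso : ∀ a ∈ Icc (0 : ℝ) ((t : ℝ) - s), ∀ b ∈ Icc (0 : ℝ) ((t : ℝ) - s),
        edist (edgePoint hvw (projIcc 0 1 zero_le_one ((s : ℝ) + a)))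
          (edgePoint hvw (projIcc 0 1 zero_le_one ((s : ℝ) + b))) = ENNReal.ofReal |a - b| := by
      intro a ha b hb
      rw [edist_edgePoint, projIcc_of_mem _ (hmem a ha), projIcc_of_mem _ (hmem b hb)]
      simp
    intro a ha b hb
    rcases lt_or_ge b a with hab | hab
    · rw [Icc_eq_empty (not_le.2 hab), inter_empty, eVariationOn.subsingleton _ (by simp),
        ENNReal.ofReal_of_nonpos]
      simp only [NNReal.coe_one, one_mul]
      linarith
    refine le_antisymm ?_ ?_
    · have hL : LipschitzOnWith 1
          (fun r => edgePoint hvw (projIcc 0 1 zero_le_one ((s : ℝ) + r)))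
          (Icc (0 : ℝ) ((t : ℝ) - s) ∩ Icc a b) := by
        intro x hx y hy
        rw [hiso x hx.1 y hy.1, ENNReal.coe_one, one_mul, edist_dist]
        rfl
      have h1 := hL.comp_eVariationOn_le (g := fun r : ℝ => r)
        (s := Icc (0 : ℝ) ((t : ℝ) - s) ∩ Icc a b) (fun _ h => h)
      have h2 : eVariationOn (fun r : ℝ => r) (Icc (0 : ℝ) ((t : ℝ) - s) ∩ Icc a b)
          ≤ ENNReal.ofReal (b - a) :=
        (MonotoneOn.eVariationOn_eq (fun x _ y _ h => h) ha hb).le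
      rw [ENNReal.coe_one, one_mul] at h1
      rw [NNReal.coe_one, one_mul]
      exact h1.trans h2
    · have h1 := eVariationOn.edist_le
        (fun r => edgePoint hvw (projIcc 0 1 zero_le_one ((s : ℝ) + r)))
        (s := Icc (0 : ℝ) ((t : ℝ) - s) ∩ Icc a b) (x := b) (y := a)
        ⟨hb, hab, le_rfl⟩ ⟨ha, le_rfl, hab⟩
      rw [hiso b hb a ha, abs_of_nonneg (sub_nonneg.2 hab)] at h1
      simpa using h1
  source := by simp
  target := by
    have hst' : (s : ℝ) ≤ t := hst
    rw [Real.coe_toNNReal _ (sub_nonneg.2 hst')]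
    simp

variable (F) in
/-- The density `ρ = α ^ (-h)` on `X`. -/
def rho (x : F.Point) : ℝ≥0∞ := ENNReal.ofReal (α ^ (-F.height x))

variable (F) in
/-- `d_ρ(x, y)`: the infimum of `∫_γ ρ ds` over all curves `γ` in `X` from `x` to `y`. -/
def rhoEDist (x y : F.Point) : ℝ≥0∞ :=
  ⨅ γ : RectifiableCurve x y, γ.lineIntegral F.rho

lemma rhoEDist_self (x : F.Point) : F.rhoEDist x x = 0 := by
  refine le_antisymm (iInf_le_of_le (RectifiableCurve.refl x) ?_) zero_le
  simp [RectifiableCurve.lineIntegral, RectifiableCurve.refl]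

lemma rhoEDist_comm (x y : F.Point) : F.rhoEDist x y = F.rhoEDist y x := by
  have key : ∀ x y : F.Point, F.rhoEDist x y ≤ F.rhoEDist y x := fun x y =>
    le_iInf fun γ => iInf_le_of_le γ.symm (γ.lineIntegral_symm _).le
  exact le_antisymm (key x y) (key y x)

lemma rhoEDist_triangle (x y z : F.Point) :
    F.rhoEDist x z ≤ F.rhoEDist x y + F.rhoEDist y z := by
  unfold rhoEDist
  rw [ENNReal.iInf_add]
  refine le_iInf fun γ => ?_
  rw [ENNReal.add_iInf]
  exact le_iInf fun η => iInf_le_of_le (γ.trans η) (γ.lineIntegral_trans_le η _)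

lemma height_coords (v w : F.Vertex) (t : ℝ) :
    ((F.coords v w t).sum fun u a => a * (u.height : ℝ))
      = (1 - t) * v.height + t * w.height := by
  classical
  unfold coords
  rw [Finsupp.sum_add_index (by simp) (by intros; ring),
    Finsupp.sum_single_index (by simp), Finsupp.sum_single_index (by simp)]

/-- Along an edge whose vertices have height at least `n`, `ρ` is at most `α⁻ⁿ`. -/
lemma rho_edgePoint_le {v w : F.Vertex} (hvw : F.graph.Adj v w) (n : ℤ) (hv : n ≤ v.height)
    (hw : n ≤ w.height) (t : I) :
    F.rho (edgePoint hvw t) ≤ ENNReal.ofReal (α ^ (-n)) := by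
  unfold rho
  refine ENNReal.ofReal_le_ofReal ?_
  rw [← Real.rpow_intCast]
  refine Real.rpow_le_rpow_of_exponent_le F.one_lt.le ?_
  have h : F.height (edgePoint hvw t) = (1 - (t : ℝ)) * v.height + t * w.height :=
    height_coords v w t
  rw [h]
  push_cast
  have hv' : (n : ℝ) ≤ v.height := by exact_mod_cast hv
  have hw' : (n : ℝ) ≤ w.height := by exact_mod_cast hw
  nlinarith [t.2.1, t.2.2]

lemma rhoEDist_edge_le {v w : F.Vertex} (hvw : F.graph.Adj v w) (n : ℤ) (hv : n ≤ v.height)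
    (hw : n ≤ w.height) (s t : I) :
    F.rhoEDist (edgePoint hvw s) (edgePoint hvw t) ≤ ENNReal.ofReal (α ^ (-n)) := by
  have key : ∀ s t : I, s ≤ t →
      F.rhoEDist (edgePoint hvw s) (edgePoint hvw t) ≤ ENNReal.ofReal (α ^ (-n)) := by
    intro s t hst
    have hst' : (s : ℝ) ≤ t := hst
    refine iInf_le_of_le (edgeCurve hvw s t hst) ?_
    calc (edgeCurve hvw s t hst).lineIntegral F.rho
        ≤ ∫⁻ _ in Icc (0 : ℝ) (edgeCurve hvw s t hst).length, ENNReal.ofReal (α ^ (-n)) :=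
          lintegral_mono fun r => rho_edgePoint_le hvw n hv hw _
      _ = ENNReal.ofReal (α ^ (-n)) * ENNReal.ofReal ((t : ℝ) - s) := by
          rw [setLIntegral_const, Real.volume_Icc]
          congr 2
          change ((Real.toNNReal ((t : ℝ) - s) : ℝ≥0) : ℝ) - 0 = _
          rw [Real.coe_toNNReal _ (sub_nonneg.2 hst'), sub_zero]
      _ ≤ ENNReal.ofReal (α ^ (-n)) * 1 := by
          gcongr
          rw [ENNReal.ofReal_le_one]
          linarith [s.2.1, t.2.2]
      _ = _ := mul_one _
  rcases le_total s t with h | h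
  · exact key s t h
  · rw [rhoEDist_comm]
    exact key t s h

lemma height_edgePoint {v w : F.Vertex} (hvw : F.graph.Adj v w) (t : I) :
    F.height (edgePoint hvw t) = (1 - (t : ℝ)) * v.height + t * w.height :=
  height_coords v w t

lemma rhoEDist_le_segLength {H : ℝ} {x y : F.Point} (hx : H ≤ F.height x) (hy : H ≤ F.height y) :
    F.rhoEDist x y ≤ ENNReal.ofReal (α ^ (-H)) * F.segLength x y := by
  have hK : 0 < α ^ (-H) := Real.rpow_pos_of_pos (by linarith [F.one_lt]) _
  have hK0 : ENNReal.ofReal (α ^ (-H)) ≠ 0 := by simpa using hK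
  have key : ∀ {v w : F.Vertex} (hvw : F.graph.Adj v w) (s t : I), s ≤ t →
      H ≤ F.height (edgePoint hvw s) → H ≤ F.height (edgePoint hvw t) →
      F.rhoEDist (edgePoint hvw s) (edgePoint hvw t)
        ≤ ENNReal.ofReal (α ^ (-H)) * ENNReal.ofReal |(s : ℝ) - t| := by
    intro v w hvw s t hst hs ht
    have hst' : (s : ℝ) ≤ t := hst
    have hlen : ((edgeCurve hvw s t hst).length : ℝ) = (t : ℝ) - s :=
      Real.coe_toNNReal _ (sub_nonneg.2 hst')
    refine iInf_le_of_le (edgeCurve hvw s t hst) ?_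
    calc (edgeCurve hvw s t hst).lineIntegral F.rho
        ≤ ∫⁻ _ in Icc (0 : ℝ) (edgeCurve hvw s t hst).length, ENNReal.ofReal (α ^ (-H)) := by
          refine setLIntegral_mono measurable_const fun r hr => ?_
          rw [hlen] at hr
          have hmem : (s : ℝ) + r ∈ Icc (0 : ℝ) 1 := by
            constructor <;> linarith [hr.1, hr.2, s.2.1, t.2.2]
          unfold rho
          refine ENNReal.ofReal_le_ofReal (Real.rpow_le_rpow_of_exponent_le F.one_lt.le ?_)
          change -F.height (edgePoint hvw (projIcc 0 1 zero_le_one ((s : ℝ) + r))) ≤ -H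
          rw [projIcc_of_mem _ hmem, neg_le_neg_iff, height_edgePoint]
          rw [height_edgePoint] at hs ht
          dsimp only
          rcases le_total ((w.height : ℝ) - v.height) 0 with h | h
          · nlinarith [hr.1, hr.2]
          · nlinarith [hr.1, hr.2]
      _ = ENNReal.ofReal (α ^ (-H)) * ENNReal.ofReal |(s : ℝ) - t| := by
          rw [setLIntegral_const, Real.volume_Icc, hlen, sub_zero, abs_sub_comm,
            abs_of_nonneg (sub_nonneg.2 hst')]
  rw [mul_comm, ← ENNReal.div_le_iff hK0 ENNReal.ofReal_ne_top]
  refine le_iInf fun v => le_iInf fun w => le_iInf fun hvw => le_iInf fun s => le_iInf fun t =>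
    le_iInf fun hs => le_iInf fun ht => ?_
  subst hs ht
  rw [ENNReal.div_le_iff hK0 ENNReal.ofReal_ne_top, mul_comm]
  rcases le_total s t with h | h
  · exact key hvw s t h hx hy
  · rw [rhoEDist_comm, abs_sub_comm]
    exact key hvw t s h hy hx

lemma abs_height_sub_le (x y : F.Point) :
    ENNReal.ofReal |F.height x - F.height y| ≤ F.segLength x y := by
  refine le_iInf fun v => le_iInf fun w => le_iInf fun hvw => le_iInf fun s => le_iInf fun t =>
    le_iInf fun hs => le_iInf fun ht => ?_
  subst hs ht
  refine ENNReal.ofReal_le_ofReal ?_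
  rw [height_edgePoint, height_edgePoint]
  have h1 : |(v.height : ℝ) - w.height| ≤ 1 := by exact_mod_cast hvw.2.1
  rw [show (1 - (s : ℝ)) * v.height + s * w.height - ((1 - (t : ℝ)) * v.height + t * w.height)
    = -(((s : ℝ) - t) * ((v.height : ℝ) - w.height)) by ring, abs_neg, abs_mul]
  exact mul_le_of_le_one_right (abs_nonneg _) h1

/-- The height function is `1`-Lipschitz along strings. -/
lemma abs_height_sub_le_string (c : ℕ → F.Point) (n : ℕ) :
    ENNReal.ofReal |F.height (c 0) - F.height (c n)|
      ≤ ∑ i ∈ Finset.range n, F.segLength (c i) (c (i + 1)) := by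
  induction n with
  | zero => simp
  | succ n ih =>
    rw [Finset.sum_range_succ]
    refine le_trans ?_ (add_le_add ih (abs_height_sub_le _ _))
    rw [← ENNReal.ofReal_add (abs_nonneg _) (abs_nonneg _)]
    exact ENNReal.ofReal_le_ofReal (abs_sub_le _ _ _)

lemma height_lipschitz : LipschitzWith 1 F.height := by
  intro x y
  rw [ENNReal.coe_one, one_mul, edist_dist, Real.dist_eq]
  refine le_iInf fun n => le_iInf fun c => le_iInf fun h0 => le_iInf fun hn => ?_
  subst h0 hn
  exact abs_height_sub_le_string c n

/-- `d_ρ` is locally controlled by the graph metric. -/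
lemma rhoEDist_le_edist {x y : F.Point} (hxy : edist x y < 1) :
    F.rhoEDist x y ≤ ENNReal.ofReal (α ^ (-(F.height x - 1))) * edist x y := by
  have hK : 0 < α ^ (-(F.height x - 1)) := Real.rpow_pos_of_pos (by linarith [F.one_lt]) _
  have hK0 : ENNReal.ofReal (α ^ (-(F.height x - 1))) ≠ 0 := by simpa using hK
  rw [mul_comm, ← ENNReal.div_le_iff hK0 ENNReal.ofReal_ne_top]
  refine le_of_forall_gt fun b hb => ?_
  have hb' : F.graphEDist x y < min b 1 := lt_min hb hxy
  unfold graphEDist at hb'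
  simp only [iInf_lt_iff] at hb'
  obtain ⟨n, c, h0, hn, hlt⟩ := hb'
  subst h0 hn
  refine lt_of_le_of_lt ?_ (hlt.trans_le (min_le_left _ _))
  have hh : ∀ i ≤ n, F.height (c 0) - 1 ≤ F.height (c i) := by
    intro i hi
    have h1 : ENNReal.ofReal |F.height (c 0) - F.height (c i)| ≤ ENNReal.ofReal 1 := by
      rw [ENNReal.ofReal_one]
      refine (abs_height_sub_le_string c i).trans (le_trans ?_
        (hlt.le.trans (min_le_right _ _)))
      exact Finset.sum_le_sum_of_subset (Finset.range_mono hi)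
    rw [ENNReal.ofReal_le_ofReal_iff zero_le_one] at h1
    linarith [(abs_le.1 h1).2]
  rw [ENNReal.div_le_iff hK0 ENNReal.ofReal_ne_top, mul_comm, Finset.mul_sum]
  have hind : ∀ m ≤ n, F.rhoEDist (c 0) (c m) ≤ ∑ i ∈ Finset.range m,
      ENNReal.ofReal (α ^ (-(F.height (c 0) - 1))) * F.segLength (c i) (c (i + 1)) := by
    intro m hm
    induction m with
    | zero => simp [rhoEDist_self]
    | succ m ih =>
      rw [Finset.sum_range_succ]
      exact (rhoEDist_triangle _ (c m) _).trans (add_le_add (ih (by omega))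
        (rhoEDist_le_segLength (hh m (by omega)) (hh (m + 1) hm)))
  exact hind n le_rfl

lemma edgePoint_zero {v w : F.Vertex} (hvw : F.graph.Adj v w) :
    edgePoint hvw 0 = F.vertexPoint v := by
  apply Subtype.ext
  simp [edgePoint, vertexPoint, coords]

lemma edgePoint_one {v w : F.Vertex} (hvw : F.graph.Adj v w) :
    edgePoint hvw 1 = F.vertexPoint w := by
  apply Subtype.ext
  simp [edgePoint, vertexPoint, coords]

lemma rhoEDist_vertex_le {v w : F.Vertex} (hvw : v = w ∨ F.graph.Adj v w) (n : ℤ)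
    (hv : n ≤ v.height) (hw : n ≤ w.height) :
    F.rhoEDist (F.vertexPoint v) (F.vertexPoint w) ≤ ENNReal.ofReal (α ^ (-n)) := by
  rcases hvw with rfl | hvw
  · rw [rhoEDist_self]
    exact zero_le
  · rw [← edgePoint_zero hvw, ← edgePoint_one hvw]
    exact rhoEDist_edge_le hvw n hv hw 0 1

variable (F)

lemma three_lt_tau (F : HyperbolicFilling Z α τ) : 3 < τ := lt_of_le_of_lt (le_max_left _ _) F.lt_tau

lemma zpow_pos' (F : HyperbolicFilling Z α τ) (n : ℤ) : 0 < α ^ n := zpow_pos (by linarith [F.one_lt]) n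

/-- The balls of radius `α⁻ⁿ` centred at the `n`-th net cover `Z`. -/
lemma exists_anchor (z : Z) (n : ℤ) :
    ∃ v : F.Vertex, v.height = n ∧ dist v.proj z < α ^ (-n) := by
  by_contra! hcon
  have hfar : ∀ x ∈ F.net n, α ^ (-n) ≤ dist x z := fun x hx => hcon ⟨(x, n), hx⟩ rfl
  have hmax := F.net_maximal n
  have hsep : (insert z (F.net n)).Pairwise fun x y => α ^ (-n) ≤ dist x y := by
    refine (pairwise_insert).2 ⟨hmax.prop, ?_⟩
    intro x hx _
    exact ⟨by rw [dist_comm]; exact hfar x hx, hfar x hx⟩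
  have hz : z ∈ F.net n := hmax.le_of_ge hsep (subset_insert _ _) (mem_insert _ _)
  have h1 := hfar z hz
  rw [dist_self] at h1
  exact absurd h1 (not_le.2 (F.zpow_pos' _))

/-- A vertex of height `n` whose (undilated) ball contains `z`. -/
def anchor (z : Z) (n : ℤ) : F.Vertex := (F.exists_anchor z n).choose

lemma height_anchor (z : Z) (n : ℤ) : (F.anchor z n).height = n :=
  (F.exists_anchor z n).choose_spec.1

lemma dist_anchor (z : Z) (n : ℤ) : dist (F.anchor z n).proj z < α ^ (-n) :=
  (F.exists_anchor z n).choose_spec.2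

variable {F}

lemma eq_or_adj {v w : F.Vertex} (h : |v.height - w.height| ≤ 1)
    (hz : (v.ball ∩ w.ball).Nonempty) : v = w ∨ F.graph.Adj v w := by
  rcases eq_or_ne v w with h' | h'
  · exact Or.inl h'
  · exact Or.inr ⟨h', h, hz⟩

lemma mem_ball_of_dist_lt {v : F.Vertex} {z : Z} (h : dist v.proj z < α ^ (-v.height)) :
    z ∈ v.ball := by
  rw [Vertex.ball, Metric.mem_ball, dist_comm]
  have := F.zpow_pos' (-v.height)
  nlinarith [F.three_lt_tau]

lemma mem_ball_proj (v : F.Vertex) : v.proj ∈ v.ball :=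
  mem_ball_of_dist_lt (by rw [dist_self]; exact F.zpow_pos' _)

lemma rhoEDist_descend_ne_top (v : F.Vertex) (k : ℕ) :
    F.rhoEDist (F.vertexPoint v) (F.vertexPoint (F.anchor v.proj (v.height - k))) ≠ ⊤ := by
  induction k with
  | zero =>
    refine ne_top_of_le_ne_top ENNReal.ofReal_ne_top
      (rhoEDist_vertex_le (eq_or_adj ?_ ⟨v.proj, mem_ball_proj v, ?_⟩) v.height le_rfl ?_)
    · rw [height_anchor]; simp
    · exact mem_ball_of_dist_lt (by rw [height_anchor]; exact F.dist_anchor _ _)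
    · rw [height_anchor]; simp
  | succ k ih =>
    refine ne_top_of_le_ne_top (ENNReal.add_ne_top.2 ⟨ih, ?_⟩) (rhoEDist_triangle _ _ _)
    refine ne_top_of_le_ne_top ENNReal.ofReal_ne_top
      (rhoEDist_vertex_le (eq_or_adj ?_ ⟨v.proj, ?_, ?_⟩) (v.height - (k + 1 : ℕ)) ?_ ?_)
    · rw [height_anchor, height_anchor]
      push_cast
      rw [show v.height - (k : ℤ) - (v.height - ((k : ℤ) + 1)) = 1 by ring]
      simp
    · exact mem_ball_of_dist_lt (by rw [height_anchor]; exact F.dist_anchor _ _)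
    · exact mem_ball_of_dist_lt (by rw [height_anchor]; exact F.dist_anchor _ _)
    · rw [height_anchor]; push_cast; linarith
    · rw [height_anchor]

lemma rhoEDist_vertex_ne_top (v w : F.Vertex) :
    F.rhoEDist (F.vertexPoint v) (F.vertexPoint w) ≠ ⊤ := by
  obtain ⟨N, hN⟩ := pow_unbounded_of_one_lt (dist v.proj w.proj) F.one_lt
  set n : ℤ := min (min v.height w.height) (-(N : ℤ)) with hn
  obtain ⟨k, hk⟩ : ∃ k : ℕ, v.height - k = n :=
    ⟨(v.height - n).toNat, by rw [Int.toNat_of_nonneg (by omega)]; ring⟩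
  obtain ⟨l, hl⟩ : ∃ l : ℕ, w.height - l = n :=
    ⟨(w.height - n).toNat, by rw [Int.toNat_of_nonneg (by omega)]; ring⟩
  have h1 := rhoEDist_descend_ne_top v k
  have h2 := rhoEDist_descend_ne_top w l
  rw [hk] at h1
  rw [hl, rhoEDist_comm] at h2
  have hd : dist v.proj w.proj < α ^ (-n) := by
    refine hN.trans_le ?_
    rw [← zpow_natCast]
    exact zpow_le_zpow_right₀ F.one_lt.le (by omega)
  have h3 : F.rhoEDist (F.vertexPoint (F.anchor v.proj n)) (F.vertexPoint (F.anchor w.proj n))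
      ≠ ⊤ := by
    refine ne_top_of_le_ne_top ENNReal.ofReal_ne_top
      (rhoEDist_vertex_le (eq_or_adj ?_ ⟨w.proj, ?_, ?_⟩) n ?_ ?_)
    · simp [height_anchor]
    · rw [Vertex.ball, Metric.mem_ball, height_anchor, dist_comm]
      have e1 := F.dist_anchor v.proj n
      have e2 := dist_triangle (F.anchor v.proj n).proj v.proj w.proj
      nlinarith [F.three_lt_tau, F.zpow_pos' (-n)]
    · exact mem_ball_of_dist_lt (by rw [height_anchor]; exact F.dist_anchor _ _)
    · rw [height_anchor]
    · rw [height_anchor]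
  exact ne_top_of_le_ne_top (ENNReal.add_ne_top.2 ⟨ENNReal.add_ne_top.2 ⟨h1, h3⟩, h2⟩)
    ((rhoEDist_triangle _ _ _).trans (add_le_add_left (rhoEDist_triangle _ _ _) _))

lemma exists_vertex_rhoEDist_ne_top (x : F.Point) :
    ∃ v : F.Vertex, F.rhoEDist x (F.vertexPoint v) ≠ ⊤ := by
  obtain ⟨x, v, w, hvw, t, rfl⟩ := x
  refine ⟨v, ?_⟩
  rcases hvw with rfl | hvw
  · have : (⟨F.coords v v t, v, v, Or.inl rfl, t, rfl⟩ : F.Point) = F.vertexPoint v := by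
      apply Subtype.ext
      simp [vertexPoint, coords]
    rw [this, rhoEDist_self]
    simp
  · have := rhoEDist_edge_le hvw (min v.height w.height) (min_le_left _ _) (min_le_right _ _) t 0
    rw [edgePoint_zero] at this
    exact ne_top_of_le_ne_top ENNReal.ofReal_ne_top this

lemma rhoEDist_ne_top (x y : F.Point) : F.rhoEDist x y ≠ ⊤ := by
  obtain ⟨v, hv⟩ := exists_vertex_rhoEDist_ne_top x
  obtain ⟨w, hw⟩ := exists_vertex_rhoEDist_ne_top y
  rw [rhoEDist_comm] at hw
  exact ne_top_of_le_ne_top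
    (ENNReal.add_ne_top.2 ⟨ENNReal.add_ne_top.2 ⟨hv, rhoEDist_vertex_ne_top v w⟩, hw⟩)
    ((rhoEDist_triangle _ _ _).trans (add_le_add_left (rhoEDist_triangle _ _ _) _))

variable (F)

/-! ### The uniformized filling and its boundary -/

/-- `X_ρ`: the set `X` with the metric `d_ρ`. -/
def Uniformized : Type _ := F.Point

/-- The identity map `X → X_ρ`. -/
def toUniformized : F.Point → F.Uniformized := fun x => x

instance : PseudoMetricSpace F.Uniformized :=
  letI : PseudoEMetricSpace F.Uniformized :=
    { edist := F.rhoEDist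
      edist_self := rhoEDist_self
      edist_comm := rhoEDist_comm
      edist_triangle := rhoEDist_triangle }
  PseudoEMetricSpace.toPseudoMetricSpace rhoEDist_ne_top

variable {F} in
/-- The identity map `X → X_ρ` is continuous. -/
lemma continuous_toUniformized : Continuous F.toUniformized := by
  rw [continuous_iff_continuousAt]
  intro x
  rw [ContinuousAt, EMetric.tendsto_nhds]
  intro ε hε
  set K := ENNReal.ofReal (α ^ (-(F.height x - 1)))
  have h1 : Tendsto (fun y : F.Point => K * edist x y) (𝓝 x) (𝓝 (K * 0)) := by
    refine ENNReal.Tendsto.const_mul ?_ (Or.inr ENNReal.ofReal_ne_top)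
    rw [← edist_self x]
    exact tendsto_const_nhds.edist tendsto_id
  rw [mul_zero] at h1
  filter_upwards [h1.eventually_lt_const hε, Metric.eball_mem_nhds x zero_lt_one] with y hy hball
  have hxy : edist x y < 1 := by
    rw [edist_comm]
    exact hball
  rw [edist_comm]
  exact lt_of_le_of_lt (rhoEDist_le_edist hxy) hy

instance : MeasurableSpace F.Uniformized := borel F.Uniformized

instance : BorelSpace F.Uniformized := ⟨rfl⟩

/-- The completion `X̄_ρ` of `X_ρ`. -/
abbrev Closure : Type _ := UniformSpace.Completion F.Uniformized

instance : MeasurableSpace F.Closure := borel F.Closure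

instance : BorelSpace F.Closure := ⟨rfl⟩

/-- A vertex as a point of `X̄_ρ`. -/
def vertexClosure (v : F.Vertex) : F.Closure := (F.toUniformized (F.vertexPoint v) : F.Closure)

/-- The canonical identification of `Z` with `∂X_ρ`: the point `z` corresponds to the limit in
`X̄_ρ` of an ascending vertical ray of vertices anchored at `z`. -/
def boundaryPoint (z : Z) : F.Closure :=
  haveI : Nonempty F.Closure := ⟨F.vertexClosure (F.anchor z 0)⟩
  limUnder atTop fun n : ℕ => F.vertexClosure (F.anchor z n)

/-- The metric on `Z` for which its identification with `∂X_ρ` is isometric. -/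
def boundaryDist (x y : Z) : ℝ := dist (F.boundaryPoint x) (F.boundaryPoint y)

variable {F} in
lemma dist_vertexClosure_le {v w : F.Vertex} {z : Z} {n : ℤ} (hv : n ≤ v.height)
    (hw : n ≤ w.height) (hvw : |v.height - w.height| ≤ 1)
    (hvz : dist v.proj z < α ^ (-v.height)) (hwz : dist w.proj z < α ^ (-w.height)) :
    dist (F.vertexClosure v) (F.vertexClosure w) ≤ α ^ (-n) := by
  unfold vertexClosure
  rw [UniformSpace.Completion.dist_eq, dist_edist]
  refine ENNReal.toReal_le_of_le_ofReal (F.zpow_pos' _).le ?_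
  exact rhoEDist_vertex_le
    (eq_or_adj hvw ⟨z, mem_ball_of_dist_lt hvz, mem_ball_of_dist_lt hwz⟩) n hv hw

/-- Every ascending vertical ray of vertices anchored at `z` converges to `z` in `X̄_ρ`. -/
lemma tendsto_boundaryPoint (z : Z) (v : ℕ → F.Vertex) (hv : ∀ n : ℕ, (v n).height = n)
    (hz : ∀ n : ℕ, dist (v n).proj z < α ^ (-(n : ℤ))) :
    Tendsto (fun n => F.vertexClosure (v n)) atTop (𝓝 (F.boundaryPoint z)) := by
  have hα0 : 0 ≤ α⁻¹ := inv_nonneg.2 (by linarith [F.one_lt])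
  have hα1 : α⁻¹ < 1 := inv_lt_one_of_one_lt₀ F.one_lt
  have hpow : ∀ n : ℕ, α ^ (-(n : ℤ)) = α⁻¹ ^ n := by
    intro n
    rw [zpow_neg, zpow_natCast, inv_pow]
  have ha : ∀ n : ℕ, (F.anchor z n).height = n := fun n => F.height_anchor z n
  have haz : ∀ n : ℕ, dist (F.anchor z n).proj z < α ^ (-(n : ℤ)) := fun n => F.dist_anchor z n
  have hcauchy : CauchySeq fun n : ℕ => F.vertexClosure (F.anchor z n) := by
    refine cauchySeq_of_le_geometric α⁻¹ 1 hα1 fun n => ?_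
    rw [one_mul, ← hpow]
    refine dist_vertexClosure_le (z := z) (by rw [ha]) (by rw [ha]; simp) ?_
      (by rw [ha]; exact haz n) (by rw [ha]; exact haz (n + 1))
    rw [ha, ha]
    push_cast
    simp
  have hlim : Tendsto (fun n : ℕ => F.vertexClosure (F.anchor z n)) atTop
      (𝓝 (F.boundaryPoint z)) := by
    obtain ⟨a, ha⟩ := cauchySeq_tendsto_of_complete hcauchy
    have : Nonempty F.Closure := ⟨a⟩
    exact tendsto_nhds_limUnder ⟨a, ha⟩
  refine (tendsto_iff_of_dist ?_).1 hlim
  refine squeeze_zero (fun _ => dist_nonneg) (fun n => ?_)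
    (tendsto_pow_atTop_nhds_zero_of_lt_one hα0 hα1)
  rw [← hpow]
  exact dist_vertexClosure_le (z := z) (by rw [ha]) (by rw [hv]) (by rw [ha, hv]; simp)
    (by rw [ha]; exact haz n) (by rw [hv]; exact hz n)

/-! ### The lifted measures -/

section Measure

variable [MeasurableSpace Z]

/-- Lebesgue measure on the edge `vw`, as a measure on `X`. -/
def edgeMeasure {v w : F.Vertex} (hvw : F.graph.Adj v w) : Measure F.Point :=
  (volume : Measure I).map (edgePoint hvw)

/-- The lift `μ` of `ν` to `X`:
`μ(A) = ∑_v ∑_{w ∼ v} (ν(B(v)) + ν(B(w))) 𝓛(A ∩ vw)`. -/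
def lift (ν : Measure Z) : Measure F.Point :=
  Measure.sum fun e : {e : F.Vertex × F.Vertex // F.graph.Adj e.1 e.2} =>
    (ν e.1.1.ball + ν e.1.2.ball) • F.edgeMeasure e.2

/-- The measure `μ_β` on `X_ρ`, `dμ_β = α ^ (-β h) dμ`. -/
def uniformizedMeasure (ν : Measure Z) (β : ℝ) : Measure F.Uniformized :=
  ((F.lift ν).withDensity fun x => ENNReal.ofReal (α ^ (-β * F.height x))).map F.toUniformized

/-- The measure `μ_β` on `X̄_ρ`, extended by `μ_β(∂X_ρ) = 0`. -/
def closureMeasure (ν : Measure Z) (β : ℝ) : Measure F.Closure :=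
  (F.uniformizedMeasure ν β).map fun x : F.Uniformized => (x : F.Closure)

/-- `g` is a hyperbolic upper gradient of `f`. Here `(f x - f y).abs` is `∞` as soon as `f x` or
`f y` is infinite, which is the usual convention in the upper gradient inequality. -/
def IsHyperbolicUpperGradient (ν : Measure Z) (f : Z → EReal) (g : F.Closure → ℝ≥0∞) : Prop :=
  Measurable g ∧ ∃ G : Set Z, ν Gᶜ = 0 ∧ ∀ x ∈ G, ∀ y ∈ G,
    ∀ γ : RectifiableCurve (F.boundaryPoint x) (F.boundaryPoint y), 0 < γ.length →
      (f x - f y).abs ≤ γ.lineIntegral g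

end Measure

end HyperbolicFilling

/-! ### Function spaces -/

/-- `‖g‖_{L^p}` for `g` with values in `[0, ∞]`. -/
def lpSeminorm {Y : Type*} [MeasurableSpace Y] (μ : Measure Y) (p : ℝ) (g : Y → ℝ≥0∞) : ℝ≥0∞ :=
  (∫⁻ x, g x ^ p ∂μ) ^ (1 / p)

section Besov

variable {Z : Type*} [MeasurableSpace Z]

/-- The Besov (semi)norm `‖f‖_{B^θ_p}` with respect to a measure `ν` and a metric `D` on `Z`
(the integrand vanishes on the diagonal where `f` is finite, as `0 / 0 = 0`). -/
def besovNorm (D : Z → Z → ℝ) (ν : Measure Z) (θ p : ℝ) (f : Z → EReal) : ℝ≥0∞ :=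
  (∫⁻ y, ∫⁻ x, (f x - f y).abs ^ p /
    (ENNReal.ofReal (D x y) ^ (p * θ) * ν {z | D x z < D x y}) ∂ν ∂ν) ^ (1 / p)

/-- Membership in the Besov space: `f ∈ L^p_loc` (that is, `f` is `ν`-measurable and
`p`-integrable on every ball) and `‖f‖_{B^θ_p} < ∞`. -/
def MemBesov (D : Z → Z → ℝ) (ν : Measure Z) (θ p : ℝ) (f : Z → EReal) : Prop :=
  AEMeasurable f ν ∧ (∀ z : Z, ∀ r : ℝ, ∫⁻ x in {x | D z x < r}, (f x).abs ^ p ∂ν < ⊤) ∧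
    besovNorm D ν θ p f < ⊤

end Besov

end

/-- A `1`-Lipschitz map of an interval can be parametrized by arc length, and this does not increase
line integrals. -/
lemma RectifiableCurve.exists_lineIntegral_le {Y : Type*} [EMetricSpace Y] {φ : ℝ → Y} {L : ℝ}
    (hL : 0 ≤ L) (hφ : LipschitzOnWith 1 φ (Icc 0 L)) (g : Y → ℝ≥0∞) :
    ∃ γ : RectifiableCurve (φ 0) (φ L),
      γ.lineIntegral g ≤ ∫⁻ t in Icc 0 L, g (φ t) := by
  have hbv : LocallyBoundedVariationOn φ (Icc 0 L) := hφ.locallyBoundedVariationOn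
  have h0 : (0 : ℝ) ∈ Icc 0 L := ⟨le_rfl, hL⟩
  have h1 : L ∈ Icc 0 L := ⟨hL, le_rfl⟩
  set ℓ : ℝ → ℝ := variationOnFromTo φ (Icc 0 L) 0 with hℓ
  have hmono : MonotoneOn ℓ (Icc 0 L) := variationOnFromTo.monotoneOn hbv h0
  have hℓ0 : ℓ 0 = 0 := variationOnFromTo.self _ _ _
  have hle : ∀ s ∈ Icc (0 : ℝ) L, ∀ t ∈ Icc (0 : ℝ) L, s ≤ t → ℓ t - ℓ s ≤ t - s := by
    intro s hs t ht hst
    have h := variationOnFromTo.add hbv h0 hs ht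
    have h2 : variationOnFromTo φ (Icc 0 L) s t ≤ t - s := by
      rw [variationOnFromTo.eq_of_le _ _ hst]
      refine ENNReal.toReal_le_of_le_ofReal (sub_nonneg.2 hst) ?_
      have h3 := (hφ.mono (inter_subset_left (t := Icc s t))).comp_eVariationOn_le
        (g := fun r : ℝ => r) (s := Icc 0 L ∩ Icc s t) (fun _ h => h)
      have h4 : eVariationOn (fun r : ℝ => r) (Icc 0 L ∩ Icc s t) ≤ ENNReal.ofReal (t - s) :=
        (MonotoneOn.eVariationOn_eq (fun x _ y _ h => h) hs ht).le
      rw [ENNReal.coe_one, one_mul] at h3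
      exact h3.trans h4
    simp only [hℓ]
    linarith
  have hlip : LipschitzOnWith 1 ℓ (Icc 0 L) := by
    refine LipschitzOnWith.of_dist_le_mul fun s hs t ht => ?_
    rw [NNReal.coe_one, one_mul]
    rcases le_total s t with h | h
    · rw [dist_comm, Real.dist_eq, dist_comm, Real.dist_eq, abs_of_nonneg (sub_nonneg.2 h),
        abs_of_nonneg (sub_nonneg.2 (hmono hs ht h))]
      exact hle s hs t ht h
    · rw [Real.dist_eq, Real.dist_eq, abs_of_nonneg (sub_nonneg.2 h),
        abs_of_nonneg (sub_nonneg.2 (hmono ht hs h))]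
      exact hle t ht s hs h
  have hℓL : 0 ≤ ℓ L := hℓ0 ▸ hmono h0 h1 hL
  have himg : ℓ '' Icc 0 L = Icc 0 (ℓ L) := by
    refine Subset.antisymm ?_ ?_
    · rintro _ ⟨t, ht, rfl⟩
      exact ⟨hℓ0 ▸ hmono h0 ht ht.1, hmono ht h1 ht.2⟩
    · have := intermediate_value_Icc hL hlip.continuousOn
      rwa [hℓ0] at this
  set ψ := naturalParameterization φ (Icc 0 L) 0 with hψ
  have hψℓ : ∀ t ∈ Icc (0 : ℝ) L, ψ (ℓ t) = φ t := fun t ht =>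
    edist_eq_zero.1 (edist_naturalParameterization_eq_zero hbv h0 ht)
  refine ⟨⟨⟨ℓ L, hℓL⟩, ψ, ?_, ?_, hψℓ L h1⟩, ?_⟩
  · have := has_unit_speed_naturalParameterization φ hbv h0
    rwa [← hℓ, himg] at this
  · rw [← hψℓ 0 h0, hℓ0]
  · have hmeas : AEMeasurable ℓ (volume.restrict (Icc 0 L)) :=
      hlip.continuousOn.aemeasurable measurableSet_Icc
    have hμ : volume.restrict (Icc 0 (ℓ L)) ≤ (volume.restrict (Icc 0 L)).map ℓ := by
      refine Measure.le_iff.2 fun E hE => ?_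
      rw [Measure.map_apply_of_aemeasurable hmeas hE, Measure.restrict_apply hE,
        Measure.restrict_apply₀' measurableSet_Icc.nullMeasurableSet]
      have hsub : E ∩ Icc 0 (ℓ L) ⊆ ℓ '' (ℓ ⁻¹' E ∩ Icc 0 L) := by
        rintro x ⟨hx, hx'⟩
        rw [← himg] at hx'
        obtain ⟨t, ht, rfl⟩ := hx'
        exact ⟨t, ⟨hx, ht⟩, rfl⟩
      refine (measure_mono hsub).trans ?_
      have := (hlip.mono (inter_subset_right (s := ℓ ⁻¹' E))).hausdorffMeasure_image_le
        (d := 1) zero_le_one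
      simpa [hausdorffMeasure_real] using this
    calc ∫⁻ s in Icc 0 (ℓ L), g (ψ s)
        ≤ ∫⁻ s, g (ψ s) ∂((volume.restrict (Icc 0 L)).map ℓ) := lintegral_mono' hμ le_rfl
      _ ≤ ∫⁻ t in Icc 0 L, g (ψ (ℓ t)) := lintegral_map_le _ _
      _ = ∫⁻ t in Icc 0 L, g (φ t) :=
        setLIntegral_congr_fun measurableSet_Icc fun t ht => by simp only [hψℓ t ht]

/-- Jensen's inequality for the power `p ≥ 1` and a measure of arbitrary total mass. -/
lemma lintegral_rpow_le_measure_univ_rpow_mul {X : Type*} [MeasurableSpace X] (m : Measure X)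
    {p : ℝ} (hp : 1 ≤ p) {c : X → ℝ≥0∞} (hc : AEMeasurable c m) :
    (∫⁻ x, c x ∂m) ^ p ≤ m univ ^ (p - 1) * ∫⁻ x, c x ^ p ∂m := by
  have hp0 : 0 < p := by linarith
  have h := eLpNorm'_le_eLpNorm'_mul_rpow_measure_univ (μ := m) zero_lt_one hp
    hc.aestronglyMeasurable
  simp only [eLpNorm', enorm_eq_self, ENNReal.rpow_one, div_one] at h
  have h2 := ENNReal.rpow_le_rpow h hp0.le
  rw [ENNReal.mul_rpow_of_nonneg _ _ hp0.le, ← ENNReal.rpow_mul, ← ENNReal.rpow_mul,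
    one_div_mul_cancel hp0.ne', ENNReal.rpow_one, show (1 - 1 / p) * p = p - 1 by field_simp,
    mul_comm] at h2
  exact h2

/-- Powers of sums of three terms. -/
lemma ENNReal.add_add_rpow_le {p : ℝ} (hp : 0 ≤ p) (a b c : ℝ≥0∞) :
    (a + b + c) ^ p ≤ 3 ^ p * (a ^ p + b ^ p + c ^ p) := by
  have h : a + b + c ≤ 3 * max (max a b) c := by
    calc a + b + c ≤ max (max a b) c + max (max a b) c + max (max a b) c := by
          gcongr
          · exact (le_max_left _ _).trans (le_max_left _ _)
          · exact (le_max_right _ _).trans (le_max_left _ _)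
          · exact le_max_right _ _
      _ = 3 * max (max a b) c := by ring
  refine (ENNReal.rpow_le_rpow h hp).trans ?_
  rw [ENNReal.mul_rpow_of_nonneg _ _ hp]
  gcongr
  rcases max_choice (max a b) c with h1 | h1
  · rw [h1]
    rcases max_choice a b with h2 | h2 <;> rw [h2]
    · rw [add_assoc]
      exact le_self_add
    · rw [add_comm (a ^ p), add_assoc]
      exact le_self_add
  · rw [h1]
    exact le_add_self

namespace HyperbolicFilling

variable {Z : Type*} [MetricSpace Z] {α τ : ℝ}

/-! ### Vertical rays -/

lemma log_pos (F : HyperbolicFilling Z α τ) : 0 < Real.log α := Real.log_pos F.one_lt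

lemma pos (F : HyperbolicFilling Z α τ) : 0 < α := zero_lt_one.trans F.one_lt

variable (F : HyperbolicFilling Z α τ)

lemma adj_anchor (z : Z) (k : ℤ) : F.graph.Adj (F.anchor z k) (F.anchor z (k + 1)) := by
  refine (eq_or_adj (by simp [height_anchor])
    ⟨z, mem_ball_of_dist_lt ?_, mem_ball_of_dist_lt ?_⟩).resolve_left fun h => ?_
  · rw [height_anchor]; exact F.dist_anchor z k
  · rw [height_anchor]; exact F.dist_anchor z (k + 1)
  · have := congrArg Vertex.height h
    simp [height_anchor] at this

/-- The point at height `u` of the vertical ray through the vertices anchored at `z`. -/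
noncomputable def ray (z : Z) (u : ℝ) : F.Point :=
  edgePoint (F.adj_anchor z ⌊u⌋) ⟨Int.fract u, Int.fract_nonneg u, (Int.fract_lt_one u).le⟩

variable {F}

lemma ray_eq (z : Z) {k : ℤ} {u : ℝ} (h0 : (k : ℝ) ≤ u) (h1 : u ≤ k + 1) :
    F.ray z u = edgePoint (F.adj_anchor z k) ⟨u - k, by linarith, by linarith⟩ := by
  rcases h1.lt_or_eq with h1 | h1
  · have hk : ⌊u⌋ = k := Int.floor_eq_iff.2 ⟨h0, h1⟩
    subst hk
    rfl
  · have hk : ⌊u⌋ = k + 1 := Int.floor_eq_iff.2 ⟨by push_cast; linarith, by push_cast; linarith⟩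
    have e1 : F.ray z u = F.vertexPoint (F.anchor z (k + 1)) := by
      rw [← hk, ← edgePoint_zero (F.adj_anchor z ⌊u⌋)]
      unfold ray
      congr 1
      apply Subtype.ext
      change Int.fract u = 0
      rw [Int.fract, hk, h1]
      push_cast
      ring
    rw [e1, ← edgePoint_one (F.adj_anchor z k)]
    congr 1
    apply Subtype.ext
    change (1 : ℝ) = u - k
    linarith

lemma ray_intCast (z : Z) (k : ℤ) : F.ray z k = F.vertexPoint (F.anchor z k) := by
  rw [ray_eq z (k := k) le_rfl (by linarith), ← edgePoint_zero (F.adj_anchor z k)]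
  congr 1
  apply Subtype.ext
  exact sub_self _

lemma height_ray (z : Z) (u : ℝ) : F.height (F.ray z u) = u := by
  rw [ray, height_edgePoint, height_anchor, height_anchor]
  have := Int.floor_add_fract u
  push_cast
  linarith

lemma edist_toUniformized (x y : F.Point) :
    edist (F.toUniformized x : F.Closure) (F.toUniformized y) = F.rhoEDist x y :=
  UniformSpace.Completion.edist_eq _ _

/-- The function `α / log α * α ^ (-u)`, which bounds the length of the part of a vertical ray
above the height `u`. -/
noncomputable def tailLength (_ : HyperbolicFilling Z α τ) (u : ℝ) : ℝ := α / Real.log α * α ^ (-u)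

lemma tailLength_pos (u : ℝ) : 0 < F.tailLength u :=
  mul_pos (div_pos F.pos F.log_pos) (Real.rpow_pos_of_pos F.pos _)

lemma rpow_mul_sub_le_tailLength {s t : ℝ} (hst : s ≤ t) (ht : t ≤ s + 1) :
    α ^ (-s) * (t - s) ≤ F.tailLength s - F.tailLength t := by
  have hα := F.pos
  have hl := F.log_pos
  have e1 : α ^ (-s) = α ^ (-t) * α ^ (t - s) := by
    rw [← Real.rpow_add hα]; congr 1; ring
  have h1 : Real.log α * (t - s) + 1 ≤ α ^ (t - s) := by
    rw [Real.rpow_def_of_pos hα]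
    exact Real.add_one_le_exp _
  have h2 : α ^ (-s) ≤ α * α ^ (-t) := by
    calc α ^ (-s) ≤ α ^ (1 + -t) := Real.rpow_le_rpow_of_exponent_le F.one_lt.le (by linarith)
      _ = α * α ^ (-t) := by rw [Real.rpow_add hα, Real.rpow_one]
  have ht0 : 0 < α ^ (-t) := Real.rpow_pos_of_pos hα _
  have key : α ^ (-t) * (Real.log α * (t - s)) ≤ α ^ (-s) - α ^ (-t) := by
    rw [e1]; nlinarith
  unfold tailLength
  rw [← mul_sub, div_mul_eq_mul_div, le_div_iff₀ hl]
  calc α ^ (-s) * (t - s) * Real.log α ≤ α * α ^ (-t) * (t - s) * Real.log α := by gcongr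
    _ = α * (α ^ (-t) * (Real.log α * (t - s))) := by ring
    _ ≤ α * (α ^ (-s) - α ^ (-t)) := by gcongr

lemma segLength_edgePoint_le {v w : F.Vertex} (hvw : F.graph.Adj v w) (s t : I) :
    F.segLength (edgePoint hvw s) (edgePoint hvw t) ≤ ENNReal.ofReal |(s : ℝ) - t| :=
  iInf_le_of_le v <| iInf_le_of_le w <| iInf_le_of_le hvw <| iInf_le_of_le s <|
    iInf_le_of_le t <| iInf_le_of_le rfl <| iInf_le_of_le rfl le_rfl

lemma rhoEDist_ray_le (z : Z) {s t : ℝ} (hst : s ≤ t) :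
    F.rhoEDist (F.ray z s) (F.ray z t) ≤ ENNReal.ofReal (F.tailLength s - F.tailLength t) := by
  have key : ∀ m : ℕ, ∀ s t : ℝ, s ≤ t → t ≤ ⌊s⌋ + 1 + m →
      F.rhoEDist (F.ray z s) (F.ray z t) ≤ ENNReal.ofReal (F.tailLength s - F.tailLength t) := by
    intro m
    have local_le : ∀ k : ℤ, ∀ s t : ℝ, k ≤ s → s ≤ t → t ≤ k + 1 →
        F.rhoEDist (F.ray z s) (F.ray z t)
          ≤ ENNReal.ofReal (F.tailLength s - F.tailLength t) := by
      intro k s t hk hst ht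
      refine (rhoEDist_le_segLength (H := s) (by rw [height_ray]) (by rwa [height_ray])).trans ?_
      rw [ray_eq z hk (hst.trans ht), ray_eq z (hk.trans hst) ht]
      refine (mul_le_mul_right (segLength_edgePoint_le _ _ _) _).trans ?_
      rw [← ENNReal.ofReal_mul (Real.rpow_nonneg F.pos.le _)]
      refine ENNReal.ofReal_le_ofReal ?_
      have : |s - (k : ℝ) - (t - k)| = t - s := by
        rw [sub_sub_sub_cancel_right, abs_sub_comm, abs_of_nonneg (sub_nonneg.2 hst)]
      dsimp only
      rw [this]
      exact rpow_mul_sub_le_tailLength hst (by linarith)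
    induction m with
    | zero =>
      intro s t hst ht
      exact local_le ⌊s⌋ s t (Int.floor_le s) hst (by simpa using ht)
    | succ m ih =>
      intro s t hst ht
      rcases le_total t (⌊s⌋ + 1) with h | h
      · exact local_le ⌊s⌋ s t (Int.floor_le s) hst h
      · have h1 := local_le ⌊s⌋ s (⌊s⌋ + 1) (Int.floor_le s) (Int.lt_floor_add_one s).le le_rfl
        have h2 := ih (⌊s⌋ + 1) t h (by
          rw [Int.floor_add_one, Int.floor_intCast]; push_cast at ht ⊢; linarith)
        refine (rhoEDist_triangle _ _ _).trans ((add_le_add h1 h2).trans ?_)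
        have hT : ∀ {a b : ℝ}, a ≤ b → 0 ≤ F.tailLength a - F.tailLength b := fun {a b} hab =>
          sub_nonneg.2 (mul_le_mul_of_nonneg_left
            (Real.rpow_le_rpow_of_exponent_le F.one_lt.le (by linarith))
            (div_pos F.pos F.log_pos).le)
        rw [← ENNReal.ofReal_add (hT (Int.lt_floor_add_one s).le) (hT h)]
        exact ENNReal.ofReal_le_ofReal (by linarith)
  obtain ⟨m, hm⟩ := exists_nat_ge (t - ⌊s⌋)
  exact key m s t hst (by linarith)

variable (F) in
/-- The vertical ray as a curve in the completed uniformized filling. -/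
noncomputable def rayClosure (z : Z) (u : ℝ) : F.Closure := (F.toUniformized (F.ray z u) : F.Closure)

lemma rayClosure_intCast (z : Z) (k : ℤ) :
    F.rayClosure z k = F.vertexClosure (F.anchor z k) := by
  rw [rayClosure, ray_intCast]
  rfl

lemma dist_rayClosure_le (z : Z) {s t : ℝ} (hst : s ≤ t) :
    dist (F.rayClosure z s) (F.rayClosure z t) ≤ F.tailLength s - F.tailLength t := by
  have h0 : 0 ≤ F.tailLength s - F.tailLength t :=
    sub_nonneg.2 (mul_le_mul_of_nonneg_left
      (Real.rpow_le_rpow_of_exponent_le F.one_lt.le (by linarith))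
      (div_pos F.pos F.log_pos).le)
  rw [dist_edist]
  refine ENNReal.toReal_le_of_le_ofReal h0 ?_
  rw [rayClosure, rayClosure, edist_toUniformized]
  exact rhoEDist_ray_le z hst

lemma tendsto_anchor_boundaryPoint (z : Z) :
    Tendsto (fun n : ℕ => F.vertexClosure (F.anchor z n)) atTop (𝓝 (F.boundaryPoint z)) :=
  F.tendsto_boundaryPoint z (fun n => F.anchor z n) (fun n => F.height_anchor z n)
    (fun n => F.dist_anchor z n)

lemma dist_boundaryPoint_rayClosure_le (z : Z) (u : ℝ) :
    dist (F.boundaryPoint z) (F.rayClosure z u) ≤ F.tailLength u := by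
  refine le_of_tendsto ((tendsto_anchor_boundaryPoint z).dist tendsto_const_nhds) ?_
  obtain ⟨m, hm⟩ := exists_nat_ge u
  filter_upwards [eventually_ge_atTop m] with n hn
  have hmn : (m : ℝ) ≤ n := by exact_mod_cast hn
  have h := dist_rayClosure_le (F := F) z (hm.trans hmn)
  have e := rayClosure_intCast (F := F) z n
  rw [Int.cast_natCast] at e
  rw [← e, dist_comm]
  linarith [F.tailLength_pos n]

lemma tailLength_log (T : ℝ) (hT : 0 < T) :
    F.tailLength (-Real.log (T * Real.log α / α) / Real.log α) = T := by
  have hα := F.pos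
  have hl := F.log_pos
  rw [tailLength, neg_div, neg_neg, Real.rpow_def_of_pos hα, mul_div_cancel₀ _ hl.ne',
    Real.exp_log (by positivity)]
  field_simp

lemma hasDerivAt_tailLength (u : ℝ) :
    HasDerivAt F.tailLength (-(α * α ^ (-u))) u := by
  have hl := F.log_pos
  have h := ((hasDerivAt_neg u).const_rpow F.pos).const_mul (α / Real.log α)
  refine h.congr_deriv ?_
  field_simp

lemma tailLength_strictAnti : StrictAnti F.tailLength := fun _ _ hst =>
  mul_lt_mul_of_pos_left (Real.rpow_lt_rpow_of_exponent_lt F.one_lt (by linarith))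
    (div_pos F.pos F.log_pos)

/-- A vertical curve from a boundary point to a vertex. -/
lemma exists_verticalCurve (z : Z) (n : ℤ) (g : F.Closure → ℝ≥0∞) :
    ∃ γ : RectifiableCurve (F.boundaryPoint z) (F.vertexClosure (F.anchor z n)),
      γ.lineIntegral g
        ≤ ∫⁻ u in Ici (n : ℝ), ENNReal.ofReal (α * α ^ (-u)) * g (F.rayClosure z u) := by
  set ψ : ℝ → ℝ := fun T => -Real.log (T * Real.log α / α) / Real.log α with hψ
  set φ : ℝ → F.Closure := fun T =>
    if T ≤ 0 then F.boundaryPoint z else F.rayClosure z (ψ T) with hφ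
  have hψT : ∀ u, ψ (F.tailLength u) = u := fun u =>
    F.tailLength_strictAnti.injective (F.tailLength_log _ (F.tailLength_pos u))
  have hφT : ∀ u, φ (F.tailLength u) = F.rayClosure z u := fun u => by
    simp only [hφ]
    rw [if_neg (not_le.2 (F.tailLength_pos u)), hψT]
  have hdist : ∀ s t : ℝ, 0 ≤ s → s ≤ t → dist (φ s) (φ t) ≤ t - s := by
    intro s t hs hst
    rcases hs.eq_or_lt with rfl | hs
    · rcases hst.eq_or_lt with rfl | ht
      · simp
      · simp only [hφ]
        rw [if_pos le_rfl, if_neg (not_le.2 ht), sub_zero]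
        refine (dist_boundaryPoint_rayClosure_le z _).trans ?_
        rw [F.tailLength_log t ht]
    · have ht := hs.trans_le hst
      simp only [hφ]
      rw [if_neg (not_le.2 hs), if_neg (not_le.2 ht), dist_comm]
      have e1 := F.tailLength_log s hs
      have e2 := F.tailLength_log t ht
      refine (dist_rayClosure_le z ?_).trans ?_
      · rw [← F.tailLength_strictAnti.le_iff_ge, e1, e2]
        exact hst
      · rw [e1, e2]
  have hlip : LipschitzOnWith 1 φ (Icc 0 (F.tailLength n)) := by
    refine LipschitzOnWith.of_dist_le_mul fun s hs t ht => ?_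
    rw [NNReal.coe_one, one_mul]
    rcases le_total s t with h | h
    · rw [dist_comm s t, Real.dist_eq, abs_of_nonneg (sub_nonneg.2 h)]
      exact hdist s t hs.1 h
    · rw [dist_comm, Real.dist_eq, abs_of_nonneg (sub_nonneg.2 h)]
      exact hdist t s ht.1 h
  obtain ⟨γ, hγ⟩ := RectifiableCurve.exists_lineIntegral_le (F.tailLength_pos n).le hlip g
  have e0 : φ 0 = F.boundaryPoint z := if_pos le_rfl
  have e1 : φ (F.tailLength n) = F.vertexClosure (F.anchor z n) := by
    rw [hφT, rayClosure_intCast]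
  have himg : Ioc 0 (F.tailLength n) ⊆ F.tailLength '' Ici (n : ℝ) := by
    intro T hT
    refine ⟨ψ T, ?_, F.tailLength_log T hT.1⟩
    rw [mem_Ici, ← F.tailLength_strictAnti.le_iff_ge, F.tailLength_log T hT.1]
    exact hT.2
  have hint : γ.lineIntegral g
      ≤ ∫⁻ u in Ici (n : ℝ), ENNReal.ofReal (α * α ^ (-u)) * g (F.rayClosure z u) := by
    calc γ.lineIntegral g ≤ ∫⁻ t in Icc 0 (F.tailLength n), g (φ t) := hγ
      _ = ∫⁻ t in Ioc 0 (F.tailLength n), g (φ t) := setLIntegral_congr Ioc_ae_eq_Icc.symm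
      _ ≤ ∫⁻ t in F.tailLength '' Ici (n : ℝ), g (φ t) := lintegral_mono_set himg
      _ = ∫⁻ u in Ici (n : ℝ),
            ENNReal.ofReal |-(α * α ^ (-u))| * g (φ (F.tailLength u)) :=
          lintegral_image_eq_lintegral_abs_deriv_mul measurableSet_Ici
            (fun u _ => (hasDerivAt_tailLength u).hasDerivWithinAt)
            F.tailLength_strictAnti.injective.injOn _
      _ = _ := by
          refine lintegral_congr fun u => ?_
          rw [hφT, abs_neg, abs_of_pos (mul_pos F.pos (Real.rpow_pos_of_pos F.pos _))]
  rw [← e0, ← e1]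
  exact ⟨γ, hint⟩

/-- A curve along a horizontal edge. -/
lemma exists_horizontalCurve {v w : F.Vertex} {n : ℤ} (hvw : F.graph.Adj v w)
    (hv : v.height = n) (hw : w.height = n) (g : F.Closure → ℝ≥0∞) :
    ∃ γ : RectifiableCurve (F.vertexClosure v) (F.vertexClosure w),
      γ.lineIntegral g ≤ ENNReal.ofReal (α ^ (-(n : ℝ)))
        * ∫⁻ t : I, g (F.toUniformized (edgePoint hvw t) : F.Closure) := by
  set c : ℝ := α ^ (-(n : ℝ)) with hc
  have hc0 : 0 < c := Real.rpow_pos_of_pos F.pos _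
  set φ : ℝ → F.Closure := fun T =>
    (F.toUniformized (edgePoint hvw (projIcc 0 1 zero_le_one (T / c))) : F.Closure) with hφ
  have hheight : ∀ t : I, F.height (edgePoint hvw t) = n := fun t => by
    rw [height_edgePoint, hv, hw]; ring
  have hlip : LipschitzOnWith 1 φ (Icc 0 c) := by
    intro s hs t ht
    rw [ENNReal.coe_one, one_mul, hφ]
    dsimp only
    rw [edist_toUniformized]
    refine (rhoEDist_le_segLength (H := n) (hheight _).ge (hheight _).ge).trans ?_
    refine (mul_le_mul_right (segLength_edgePoint_le _ _ _) _).trans ?_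
    have hmem : ∀ r ∈ Icc (0 : ℝ) c, r / c ∈ Icc (0 : ℝ) 1 := fun r hr =>
      ⟨div_nonneg hr.1 hc0.le, (div_le_one hc0).2 hr.2⟩
    rw [projIcc_of_mem _ (hmem s hs), projIcc_of_mem _ (hmem t ht), ← hc,
      ← ENNReal.ofReal_mul hc0.le, edist_dist, Real.dist_eq]
    refine ENNReal.ofReal_le_ofReal (le_of_eq ?_)
    dsimp only
    rw [← sub_div, abs_div, abs_of_pos hc0, mul_div_cancel₀ _ hc0.ne']
  obtain ⟨γ, hγ⟩ := RectifiableCurve.exists_lineIntegral_le hc0.le hlip g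
  have e0 : φ 0 = F.vertexClosure v := by
    simp only [hφ, zero_div, projIcc_left, vertexClosure]
    rw [← edgePoint_zero hvw]
    rfl
  have e1 : φ c = F.vertexClosure w := by
    simp only [hφ, div_self hc0.ne', projIcc_right, vertexClosure]
    rw [← edgePoint_one hvw]
    rfl
  have hint : γ.lineIntegral g ≤ ENNReal.ofReal c
      * ∫⁻ t : I, g (F.toUniformized (edgePoint hvw t) : F.Closure) := by
    refine hγ.trans ?_
    have himg : Icc 0 c = (fun x : ℝ => c * x) '' Icc (0 : ℝ) 1 := by
      rw [image_mul_left_Icc hc0.le zero_le_one, mul_zero, mul_one]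
    rw [himg, lintegral_image_eq_lintegral_abs_deriv_mul (f' := fun _ => c) measurableSet_Icc
      (fun x _ => by simpa using ((hasDerivAt_id x).const_mul c).hasDerivWithinAt)
      (mul_right_injective₀ hc0.ne').injOn]
    rw [lintegral_const_mul' _ _ ENNReal.ofReal_ne_top, abs_of_pos hc0,
      ← lintegral_subtype_comap measurableSet_Icc]
    refine mul_le_mul_right (le_of_eq (lintegral_congr fun t => ?_)) _
    simp only [hφ, mul_div_cancel_left₀ _ hc0.ne', projIcc_val]
  rw [← e0, ← e1]
  exact ⟨γ, hint⟩

end HyperbolicFilling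

lemma RectifiableCurve.edist_toFun_le {Y : Type*} [PseudoEMetricSpace Y] {x y : Y}
    (γ : RectifiableCurve x y) {s t : ℝ} (hs : 0 ≤ s) (hst : s ≤ t) (ht : t ≤ γ.length) :
    edist (γ.toFun s) (γ.toFun t) ≤ ENNReal.ofReal (t - s) := by
  have h1 := γ.unitSpeed ⟨hs, hst.trans ht⟩ ⟨hs.trans hst, ht⟩
  rw [NNReal.coe_one, one_mul] at h1
  rw [← h1]
  exact eVariationOn.edist_le _ ⟨⟨hs, hst.trans ht⟩, le_rfl, hst⟩ ⟨⟨hs.trans hst, ht⟩, hst, le_rfl⟩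

namespace HyperbolicFilling

variable {Z : Type*} [MetricSpace Z] {α τ : ℝ} {F : HyperbolicFilling Z α τ}

/-! ### Functions which are Lipschitz with respect to `d_ρ` -/

lemma rho_le_mul_rho {x y : F.Point} (h : F.height y ≤ F.height x + 1) :
    F.rho x ≤ ENNReal.ofReal α * F.rho y := by
  unfold rho
  rw [← ENNReal.ofReal_mul F.pos.le]
  refine ENNReal.ofReal_le_ofReal ?_
  calc α ^ (-F.height x) ≤ α ^ (1 + -F.height y) :=
        Real.rpow_le_rpow_of_exponent_le F.one_lt.le (by linarith)
    _ = α * α ^ (-F.height y) := by rw [Real.rpow_add F.pos, Real.rpow_one]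

lemma rho_ne_zero (x : F.Point) : F.rho x ≠ 0 := by
  simpa [rho] using Real.rpow_pos_of_pos F.pos _

lemma rho_ne_top (x : F.Point) : F.rho x ≠ ⊤ := ENNReal.ofReal_ne_top

lemma abs_sub_le_mul_edist {Ψ : F.Point → ℝ} {K : ℝ} (hK : 0 < K)
    (hΨ : ∀ {v w : F.Vertex} (hvw : F.graph.Adj v w) (s t : I),
      |Ψ (edgePoint hvw s) - Ψ (edgePoint hvw t)|
        ≤ K * α ^ (-F.height (edgePoint hvw s)) * |(s : ℝ) - t|)
    {x y : F.Point} (hxy : edist x y < 1) :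
    ENNReal.ofReal |Ψ x - Ψ y| ≤ ENNReal.ofReal (K * α) * F.rho x * edist x y := by
  have hseg : ∀ a b : F.Point,
      ENNReal.ofReal |Ψ a - Ψ b| ≤ ENNReal.ofReal K * F.rho a * F.segLength a b := by
    intro a b
    have h0 : ENNReal.ofReal K * F.rho a ≠ 0 := mul_ne_zero (by simpa using hK) (rho_ne_zero a)
    have h1 : ENNReal.ofReal K * F.rho a ≠ ⊤ := ENNReal.mul_ne_top ENNReal.ofReal_ne_top
      (rho_ne_top a)
    rw [mul_comm, ← ENNReal.div_le_iff h0 h1]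
    refine le_iInf fun v => le_iInf fun w => le_iInf fun hvw => le_iInf fun s => le_iInf fun t =>
      le_iInf fun hs => le_iInf fun ht => ?_
    rw [ENNReal.div_le_iff h0 h1, mul_comm]
    subst hs ht
    rw [rho, ← ENNReal.ofReal_mul hK.le, ← ENNReal.ofReal_mul
      (mul_nonneg hK.le (Real.rpow_nonneg F.pos.le _))]
    exact ENNReal.ofReal_le_ofReal (hΨ hvw s t)
  set M := ENNReal.ofReal (K * α) * F.rho x with hM
  have h0 : M ≠ 0 := mul_ne_zero (by simpa using mul_pos hK F.pos) (rho_ne_zero x)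
  have h1 : M ≠ ⊤ := ENNReal.mul_ne_top ENNReal.ofReal_ne_top (rho_ne_top x)
  rw [mul_comm, ← ENNReal.div_le_iff h0 h1]
  refine le_of_forall_gt fun b hb => ?_
  have hb' : F.graphEDist x y < min b 1 := lt_min hb hxy
  unfold graphEDist at hb'
  simp only [iInf_lt_iff] at hb'
  obtain ⟨n, c, hc0, hcn, hlt⟩ := hb'
  refine lt_of_le_of_lt ?_ (hlt.trans_le (min_le_left _ _))
  rw [ENNReal.div_le_iff h0 h1, mul_comm, Finset.mul_sum]
  have hrho : ∀ i ≤ n, ENNReal.ofReal K * F.rho (c i) ≤ M := by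
    intro i hi
    have h2 : ENNReal.ofReal |F.height (c 0) - F.height (c i)| ≤ ENNReal.ofReal 1 := by
      rw [ENNReal.ofReal_one]
      refine (abs_height_sub_le_string c i).trans (le_trans ?_
        (hlt.le.trans (min_le_right _ _)))
      exact Finset.sum_le_sum_of_subset (Finset.range_mono hi)
    rw [ENNReal.ofReal_le_ofReal_iff zero_le_one] at h2
    rw [hM, ENNReal.ofReal_mul hK.le, mul_assoc, ← hc0]
    gcongr
    exact rho_le_mul_rho (by linarith [(abs_le.1 h2).2])
  have hind : ∀ m ≤ n, ENNReal.ofReal |Ψ (c 0) - Ψ (c m)|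
      ≤ ∑ i ∈ Finset.range m, M * F.segLength (c i) (c (i + 1)) := by
    intro m hm
    induction m with
    | zero => simp
    | succ m ih =>
      rw [Finset.sum_range_succ]
      refine le_trans ?_ (add_le_add (ih (by omega)) ((hseg (c m) (c (m + 1))).trans
        (mul_le_mul_left (hrho m (by omega)) _)))
      rw [← ENNReal.ofReal_add (abs_nonneg _) (abs_nonneg _)]
      exact ENNReal.ofReal_le_ofReal (abs_sub_le _ _ _)
  rw [← hc0, ← hcn]
  exact hind n le_rfl

lemma abs_sub_le_mul_rhoEDist {Ψ : F.Point → ℝ} {K : ℝ} (hK : 0 < K)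
    (hΨ : ∀ {v w : F.Vertex} (hvw : F.graph.Adj v w) (s t : I),
      |Ψ (edgePoint hvw s) - Ψ (edgePoint hvw t)|
        ≤ K * α ^ (-F.height (edgePoint hvw s)) * |(s : ℝ) - t|)
    (x y : F.Point) :
    ENNReal.ofReal |Ψ x - Ψ y| ≤ ENNReal.ofReal (K * α ^ 2) * F.rhoEDist x y := by
  have hα := F.pos
  set M := ENNReal.ofReal (K * α ^ 2) with hM
  have h0 : M ≠ 0 := by simpa [hM] using mul_pos hK (pow_pos hα 2)
  rw [mul_comm, ← ENNReal.div_le_iff h0 ENNReal.ofReal_ne_top]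
  refine le_iInf fun γ => ?_
  rw [ENNReal.div_le_iff h0 ENNReal.ofReal_ne_top, mul_comm]
  have hstep : ∀ s t : ℝ, 0 ≤ s → s ≤ t → t ≤ γ.length → t < s + 1 →
      ENNReal.ofReal |Ψ (γ.toFun s) - Ψ (γ.toFun t)|
        ≤ M * ∫⁻ r in Ioc s t, F.rho (γ.toFun r) := by
    intro s t hs hst ht hst1
    have hd : edist (γ.toFun s) (γ.toFun t) < 1 := by
      refine (γ.edist_toFun_le hs hst ht).trans_lt ?_
      rw [ENNReal.ofReal_lt_one]
      linarith
    refine (abs_sub_le_mul_edist hK hΨ hd).trans ?_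
    have hint : F.rho (γ.toFun s) * ENNReal.ofReal (t - s)
        ≤ ENNReal.ofReal α * ∫⁻ r in Ioc s t, F.rho (γ.toFun r) := by
      rw [← Real.volume_Ioc, ← setLIntegral_const,
        ← lintegral_const_mul' _ _ ENNReal.ofReal_ne_top]
      refine setLIntegral_mono' measurableSet_Ioc fun r hr => rho_le_mul_rho ?_
      have h2 := (height_lipschitz (F := F)) (γ.toFun r) (γ.toFun s)
      rw [ENNReal.coe_one, one_mul, edist_comm (γ.toFun r)] at h2
      have h3 := h2.trans (γ.edist_toFun_le hs hr.1.le (hr.2.trans ht))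
      rw [edist_dist, ENNReal.ofReal_le_ofReal_iff (by linarith [hr.1]), Real.dist_eq] at h3
      linarith [(abs_le.1 h3).2, hr.2]
    calc ENNReal.ofReal (K * α) * F.rho (γ.toFun s) * edist (γ.toFun s) (γ.toFun t)
        ≤ ENNReal.ofReal (K * α) * F.rho (γ.toFun s) * ENNReal.ofReal (t - s) := by
          gcongr
          exact γ.edist_toFun_le hs hst ht
      _ ≤ ENNReal.ofReal (K * α) * (ENNReal.ofReal α * ∫⁻ r in Ioc s t, F.rho (γ.toFun r)) := by
          rw [mul_assoc]
          gcongr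
      _ = M * ∫⁻ r in Ioc s t, F.rho (γ.toFun r) := by
          rw [← mul_assoc, ← ENNReal.ofReal_mul (by positivity), hM]
          congr 2
          ring
  have hind : ∀ m : ℕ, ∀ t : ℝ, 0 ≤ t → t ≤ γ.length → t ≤ m / 2 →
      ENNReal.ofReal |Ψ (γ.toFun 0) - Ψ (γ.toFun t)|
        ≤ M * ∫⁻ r in Ioc 0 t, F.rho (γ.toFun r) := by
    intro m
    induction m with
    | zero =>
      intro t h0 _ ht
      have : t = 0 := le_antisymm (by simpa using ht) h0
      simp [this]
    | succ m ih =>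
      intro t h0 hL ht
      push_cast at ht
      set s : ℝ := max 0 (t - 1 / 2) with hs
      have hs0 : 0 ≤ s := le_max_left _ _
      have hst : s ≤ t := max_le h0 (by linarith)
      have hts : t - 1 / 2 ≤ s := le_max_right _ _
      have h1 := ih s hs0 (hst.trans hL)
        (max_le (by positivity) (by linarith))
      have h2 := hstep s t hs0 hst hL (by linarith)
      rw [← Ioc_union_Ioc_eq_Ioc hs0 hst, lintegral_union measurableSet_Ioc
        (Ioc_disjoint_Ioc_of_le le_rfl), mul_add]
      refine le_trans ?_ (add_le_add h1 h2)
      rw [← ENNReal.ofReal_add (abs_nonneg _) (abs_nonneg _)]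
      exact ENNReal.ofReal_le_ofReal (abs_sub_le _ _ _)
  obtain ⟨m, hm⟩ := exists_nat_ge (2 * (γ.length : ℝ))
  have h := hind m γ.length γ.length.2 le_rfl (by linarith)
  rw [γ.source, γ.target] at h
  refine h.trans ?_
  gcongr
  exact lintegral_mono_set Ioc_subset_Icc_self

lemma abs_sub_le_mul_dist {Ψ : F.Point → ℝ} {K : ℝ} (hK : 0 < K)
    (hΨ : ∀ {v w : F.Vertex} (hvw : F.graph.Adj v w) (s t : I),
      |Ψ (edgePoint hvw s) - Ψ (edgePoint hvw t)|
        ≤ K * α ^ (-F.height (edgePoint hvw s)) * |(s : ℝ) - t|)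
    (v w : F.Vertex) :
    |Ψ (F.vertexPoint v) - Ψ (F.vertexPoint w)|
      ≤ K * α ^ 2 * dist (F.vertexClosure v) (F.vertexClosure w) := by
  have h := abs_sub_le_mul_rhoEDist hK hΨ (F.vertexPoint v) (F.vertexPoint w)
  have hK2 : 0 ≤ K * α ^ 2 := by positivity
  rw [← edist_toUniformized, edist_dist, ← ENNReal.ofReal_mul hK2,
    ENNReal.ofReal_le_ofReal_iff (mul_nonneg hK2 dist_nonneg)] at h
  exact h

lemma height_vertexPoint (v : F.Vertex) : F.height (F.vertexPoint v) = v.height := by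
  rw [height, vertexPoint, height_coords]
  ring

lemma abs_rpow_neg_height_sub_le {v w : F.Vertex} (hvw : F.graph.Adj v w) (s t : I) :
    |α ^ (-F.height (edgePoint hvw s)) - α ^ (-F.height (edgePoint hvw t))|
      ≤ α * Real.log α * α ^ (-F.height (edgePoint hvw s)) * |(s : ℝ) - t| := by
  have hα := F.pos
  have hl := F.log_pos
  set a := F.height (edgePoint hvw s) with ha
  set b := F.height (edgePoint hvw t) with hb
  have hab : |a - b| ≤ |(s : ℝ) - t| := by
    have h1 : |(v.height : ℝ) - w.height| ≤ 1 := by exact_mod_cast hvw.2.1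
    rw [ha, hb, height_edgePoint, height_edgePoint,
      show (1 - (s : ℝ)) * v.height + s * w.height
        - ((1 - (t : ℝ)) * v.height + t * w.height)
        = -(((s : ℝ) - t) * ((v.height : ℝ) - w.height)) by ring, abs_neg, abs_mul]
    exact mul_le_of_le_one_right (abs_nonneg _) h1
  have hst : |(s : ℝ) - t| ≤ 1 :=
    abs_le.2 ⟨by linarith [s.2.1, t.2.2], by linarith [s.2.2, t.2.1]⟩
  have key : ∀ x y : ℝ, x ≤ y → α ^ (-x) - α ^ (-y) ≤ Real.log α * α ^ (-x) * (y - x) := by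
    intro x y _
    have e1 : α ^ (-y) = α ^ (-x) * α ^ (x - y) := by
      rw [← Real.rpow_add hα]; congr 1; ring
    have h1 : Real.log α * (x - y) + 1 ≤ α ^ (x - y) := by
      rw [Real.rpow_def_of_pos hα]
      exact Real.add_one_le_exp _
    have h2 : 0 < α ^ (-x) := Real.rpow_pos_of_pos hα _
    rw [e1]
    nlinarith
  have hmono : ∀ {x y : ℝ}, x ≤ y → α ^ (-y) ≤ α ^ (-x) := fun h =>
    Real.rpow_le_rpow_of_exponent_le F.one_lt.le (by linarith)
  have ha0 : 0 < α ^ (-a) := Real.rpow_pos_of_pos hα _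
  rcases le_total a b with h | h
  · rw [abs_of_nonneg (sub_nonneg.2 (hmono h))]
    rw [abs_sub_comm, abs_of_nonneg (sub_nonneg.2 h)] at hab
    calc α ^ (-a) - α ^ (-b) ≤ Real.log α * α ^ (-a) * (b - a) := key a b h
      _ ≤ Real.log α * α ^ (-a) * |(s : ℝ) - t| := by gcongr
      _ = 1 * Real.log α * α ^ (-a) * |(s : ℝ) - t| := by ring
      _ ≤ α * Real.log α * α ^ (-a) * |(s : ℝ) - t| := by
          gcongr
          exact F.one_lt.le
  · rw [abs_sub_comm, abs_of_nonneg (sub_nonneg.2 (hmono h))]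
    rw [abs_of_nonneg (sub_nonneg.2 h)] at hab
    have h3 : α ^ (-b) ≤ α * α ^ (-a) := by
      calc α ^ (-b) ≤ α ^ (1 + -a) :=
            Real.rpow_le_rpow_of_exponent_le F.one_lt.le (by linarith)
        _ = α * α ^ (-a) := by rw [Real.rpow_add hα, Real.rpow_one]
    calc α ^ (-b) - α ^ (-a) ≤ Real.log α * α ^ (-b) * (a - b) := key b a h
      _ ≤ Real.log α * (α * α ^ (-a)) * |(s : ℝ) - t| := by
          gcongr
      _ = α * Real.log α * α ^ (-a) * |(s : ℝ) - t| := by ring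

lemma boundaryPoint_ne_vertexClosure (z : Z) (v : F.Vertex) :
    F.boundaryPoint z ≠ F.vertexClosure v := by
  intro h
  have hK : 0 < α * Real.log α := mul_pos F.pos F.log_pos
  have h1 : Tendsto (fun n : ℕ => α ^ (-(v.height : ℝ)) - α ^ (-(n : ℝ))) atTop
      (𝓝 (α ^ (-(v.height : ℝ)) - 0)) := by
    refine tendsto_const_nhds.sub ?_
    have h2 := tendsto_pow_atTop_nhds_zero_of_lt_one (inv_nonneg.2 F.pos.le)
      (inv_lt_one_of_one_lt₀ F.one_lt)
    refine h2.congr fun n => ?_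
    rw [Real.rpow_neg F.pos.le, Real.rpow_natCast, inv_pow]
  have h2 : Tendsto (fun n : ℕ => α * Real.log α * α ^ 2 *
      dist (F.vertexClosure v) (F.vertexClosure (F.anchor z n))) atTop (𝓝 0) := by
    have := ((tendsto_const_nhds (x := F.vertexClosure v)).dist
      (tendsto_anchor_boundaryPoint (F := F) z)).const_mul (α * Real.log α * α ^ 2)
    rwa [h, dist_self, mul_zero] at this
  have h3 := le_of_tendsto_of_tendsto h1 h2 (Eventually.of_forall fun n => by
    have h4 := abs_sub_le_mul_dist (F := F) (Ψ := fun x => α ^ (-F.height x)) hK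
      (fun hvw s t => abs_rpow_neg_height_sub_le hvw s t) v (F.anchor z n)
    simp only [height_vertexPoint, height_anchor] at h4
    exact (le_abs_self _).trans h4)
  have h4 := Real.rpow_pos_of_pos F.pos (-(v.height : ℝ))
  linarith

/-! ### The boundary metric is comparable to the metric of `Z` -/

/-- The distance to `x` of the projections of vertices, extended linearly to the edges. -/
noncomputable def projDist (x : Z) (a : F.Point) : ℝ := a.1.sum fun v c => c * dist v.proj x

lemma projDist_coords (x : Z) (v w : F.Vertex) (t : ℝ) :
    ((F.coords v w t).sum fun u c => c * dist u.proj x)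
      = (1 - t) * dist v.proj x + t * dist w.proj x := by
  classical
  unfold coords
  rw [Finsupp.sum_add_index (by simp) (by intros; ring),
    Finsupp.sum_single_index (by simp), Finsupp.sum_single_index (by simp)]

lemma projDist_vertexPoint (x : Z) (v : F.Vertex) :
    projDist x (F.vertexPoint v) = dist v.proj x := by
  rw [projDist, vertexPoint, projDist_coords]
  ring

lemma tau_pos (F : HyperbolicFilling Z α τ) : 0 < τ := by linarith [F.three_lt_tau]

lemma dist_proj_lt {v w : F.Vertex} (hvw : F.graph.Adj v w) :
    dist v.proj w.proj < τ * α ^ (-v.height) + τ * α ^ (-w.height) := by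
  obtain ⟨z, h1, h2⟩ := hvw.2.2
  rw [Vertex.ball, Metric.mem_ball] at h1 h2
  rw [dist_comm] at h1
  linarith [dist_triangle v.proj z w.proj]

lemma abs_projDist_sub_le (x : Z) {v w : F.Vertex} (hvw : F.graph.Adj v w) (s t : I) :
    |projDist x (edgePoint hvw s) - projDist x (edgePoint hvw t)|
      ≤ 2 * τ * α * α ^ (-F.height (edgePoint hvw s)) * |(s : ℝ) - t| := by
  have hα := F.pos
  have hτ := F.tau_pos
  have e : ∀ r : I, projDist x (edgePoint hvw r)
      = (1 - (r : ℝ)) * dist v.proj x + r * dist w.proj x := fun r => projDist_coords x v w r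
  rw [e, e, show (1 - (s : ℝ)) * dist v.proj x + s * dist w.proj x
    - ((1 - (t : ℝ)) * dist v.proj x + t * dist w.proj x)
    = (dist w.proj x - dist v.proj x) * ((s : ℝ) - t) by ring, abs_mul]
  refine mul_le_mul_of_nonneg_right ?_ (abs_nonneg _)
  have h1 : |(v.height : ℝ) - w.height| ≤ 1 := by exact_mod_cast hvw.2.1
  obtain ⟨h1, h2⟩ := abs_le.1 h1
  have hle : ∀ m : ℤ, F.height (edgePoint hvw s) ≤ m + 1 →
      α ^ (-m) ≤ α * α ^ (-F.height (edgePoint hvw s)) := by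
    intro m hm
    rw [← Real.rpow_intCast]
    calc α ^ (((-m : ℤ)) : ℝ) ≤ α ^ (1 + -F.height (edgePoint hvw s)) :=
          Real.rpow_le_rpow_of_exponent_le F.one_lt.le (by push_cast; linarith)
      _ = _ := by rw [Real.rpow_add hα, Real.rpow_one]
  have h3 := hle v.height (by rw [height_edgePoint]; nlinarith [s.2.1, s.2.2])
  have h4 := hle w.height (by rw [height_edgePoint]; nlinarith [s.2.1, s.2.2])
  calc |dist w.proj x - dist v.proj x| ≤ dist w.proj v.proj := abs_dist_sub_le _ _ _
    _ = dist v.proj w.proj := dist_comm _ _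
    _ ≤ τ * α ^ (-v.height) + τ * α ^ (-w.height) := (dist_proj_lt hvw).le
    _ ≤ τ * (α * α ^ (-F.height (edgePoint hvw s)))
        + τ * (α * α ^ (-F.height (edgePoint hvw s))) := by gcongr
    _ = _ := by ring

lemma tendsto_proj_anchor (F : HyperbolicFilling Z α τ) (z : Z) :
    Tendsto (fun n : ℕ => (F.anchor z n).proj) atTop (𝓝 z) := by
  rw [tendsto_iff_dist_tendsto_zero]
  refine squeeze_zero (fun _ => dist_nonneg) (fun n => (F.dist_anchor z n).le) ?_
  refine (tendsto_pow_atTop_nhds_zero_of_lt_one (inv_nonneg.2 F.pos.le)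
    (inv_lt_one_of_one_lt₀ F.one_lt)).congr fun n => ?_
  rw [zpow_neg, zpow_natCast, inv_pow]

lemma dist_le_mul_boundaryDist (F : HyperbolicFilling Z α τ) (x y : Z) :
    dist x y ≤ 2 * τ * α ^ 3 * F.boundaryDist x y := by
  have hK : 0 < 2 * τ * α := mul_pos (mul_pos two_pos F.tau_pos) F.pos
  have h1 : Tendsto (fun n : ℕ => dist (F.anchor y n).proj x - dist (F.anchor x n).proj x) atTop
      (𝓝 (dist y x - dist x x)) :=
    ((F.tendsto_proj_anchor y).dist tendsto_const_nhds).sub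
      ((F.tendsto_proj_anchor x).dist tendsto_const_nhds)
  have h2 : Tendsto (fun n : ℕ => 2 * τ * α * α ^ 2 *
      dist (F.vertexClosure (F.anchor y n)) (F.vertexClosure (F.anchor x n))) atTop
      (𝓝 (2 * τ * α * α ^ 2 * dist (F.boundaryPoint y) (F.boundaryPoint x))) :=
    ((tendsto_anchor_boundaryPoint y).dist (tendsto_anchor_boundaryPoint x)).const_mul _
  have h3 := le_of_tendsto_of_tendsto h1 h2 (Eventually.of_forall fun n => by
    have h4 := abs_sub_le_mul_dist (F := F) (Ψ := projDist x) hK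
      (fun hvw s t => abs_projDist_sub_le x hvw s t) (F.anchor y n) (F.anchor x n)
    simp only [projDist_vertexPoint] at h4
    exact (le_abs_self _).trans h4)
  rw [dist_self, sub_zero, dist_comm, dist_comm (F.boundaryPoint y)] at h3
  refine h3.trans (le_of_eq ?_)
  rw [boundaryDist]
  ring

/-- The level of a pair of points: `α ^ (-n)` is comparable to a given positive number. -/
lemma exists_level (hα : 1 < α) {d : ℝ} (hd : 0 < d) :
    ∃ n : ℤ, α ^ (-(n : ℝ)) ≤ α * d ∧ d < α ^ (-(n : ℝ)) := by
  obtain ⟨m, h1, h2⟩ := exists_mem_Ico_zpow hd hα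
  refine ⟨-(m + 1), ?_, ?_⟩
  · push_cast
    rw [neg_neg, Real.rpow_add (by linarith), Real.rpow_one, Real.rpow_intCast, mul_comm]
    gcongr
  · push_cast
    rw [neg_neg]
    exact_mod_cast h2

lemma anchor_eq_or_adj (F : HyperbolicFilling Z α τ) {x y : Z} {n : ℤ}
    (h : dist x y < α ^ (-(n : ℝ))) :
    F.anchor x n = F.anchor y n ∨ F.graph.Adj (F.anchor x n) (F.anchor y n) := by
  have h' : dist x y < α ^ (-n) := by
    rw [← Real.rpow_intCast]
    exact_mod_cast h
  refine eq_or_adj (by simp [height_anchor]) ⟨y, ?_, mem_ball_of_dist_lt ?_⟩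
  · rw [Vertex.ball, Metric.mem_ball, height_anchor, dist_comm]
    have e1 := F.dist_anchor x n
    have e2 := dist_triangle (F.anchor x n).proj x y
    nlinarith [F.three_lt_tau, F.zpow_pos' (-n)]
  · rw [height_anchor]
    exact F.dist_anchor _ _

lemma boundaryDist_le_mul_dist (F : HyperbolicFilling Z α τ) (x y : Z) :
    F.boundaryDist x y ≤ (2 * (α / Real.log α) + 1) * α * dist x y := by
  have hα := F.pos
  have hl := F.log_pos
  rcases eq_or_ne x y with rfl | hxy
  · simp [boundaryDist]
  obtain ⟨n, h1, h2⟩ := exists_level F.one_lt (dist_pos.2 hxy)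
  have hx := dist_boundaryPoint_rayClosure_le (F := F) x n
  have hy := dist_boundaryPoint_rayClosure_le (F := F) y n
  rw [rayClosure_intCast] at hx hy
  rw [dist_comm] at hy
  have hm : dist (F.vertexClosure (F.anchor x n)) (F.vertexClosure (F.anchor y n))
      ≤ α ^ (-(n : ℝ)) := by
    have h3 := rhoEDist_vertex_le (F.anchor_eq_or_adj h2) n (F.height_anchor x n).ge
      (F.height_anchor y n).ge
    rw [← edist_toUniformized, edist_dist, ENNReal.ofReal_le_ofReal_iff (F.zpow_pos' _).le,
      ← Real.rpow_intCast] at h3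
    push_cast at h3
    exact h3
  have h4 := dist_triangle4 (F.boundaryPoint x) (F.vertexClosure (F.anchor x n))
    (F.vertexClosure (F.anchor y n)) (F.boundaryPoint y)
  calc F.boundaryDist x y ≤ (2 * (α / Real.log α) + 1) * α ^ (-(n : ℝ)) := by
        unfold boundaryDist
        unfold tailLength at hx hy
        linarith
    _ ≤ (2 * (α / Real.log α) + 1) * (α * dist x y) := by gcongr
    _ = _ := by ring

end HyperbolicFilling

/-- The integral of `α ^ (-θ u)` over `[n, ∞)`. -/
lemma setLIntegral_Ici_rpow_neg_le {α θ : ℝ} (hα : 1 < α) (hθ : 0 < θ) (n : ℝ) :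
    ∫⁻ u in Ici n, ENNReal.ofReal (α ^ (-θ * u))
      ≤ ENNReal.ofReal (α ^ (-θ * n) / (θ * Real.log α)) := by
  have hα0 : 0 < α := by linarith
  have hl : 0 < θ * Real.log α := mul_pos hθ (Real.log_pos hα)
  set f : ℝ → ℝ := fun u => α ^ (-θ * u) / (θ * Real.log α) with hf
  have hanti : StrictAnti f := fun s t hst => by
    simp only [hf]
    gcongr ?_ / _
    exact Real.rpow_lt_rpow_of_exponent_lt hα (by nlinarith)
  have hderiv : ∀ u, HasDerivAt f (-α ^ (-θ * u)) u := fun u => by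
    have h := (((hasDerivAt_id u).const_mul (-θ)).const_rpow hα0).div_const (θ * Real.log α)
    refine h.congr_deriv ?_
    have := (Real.log_pos hα).ne'
    simp only [id]
    field_simp
  have h := lintegral_image_eq_lintegral_abs_deriv_mul (measurableSet_Ici (a := n))
    (fun u _ => (hderiv u).hasDerivWithinAt) hanti.injective.injOn (fun _ => 1)
  have e : ∀ u, |(-α ^ (-θ * u))| = α ^ (-θ * u) := fun u => by
    rw [abs_neg, abs_of_pos (Real.rpow_pos_of_pos hα0 _)]
  simp only [e, mul_one] at h
  rw [← h, setLIntegral_one]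
  have hsub : f '' Ici n ⊆ Icc 0 (f n) := by
    rintro _ ⟨u, hu, rfl⟩
    exact ⟨div_nonneg (Real.rpow_nonneg hα0.le _) hl.le, hanti.antitone hu⟩
  refine (measure_mono hsub).trans ?_
  rw [Real.volume_Icc, sub_zero]

/-- An integral over an interval of length one, written as an integral over `[0, 1]`. -/
lemma setLIntegral_Icc_add_one (k : ℝ) (h : ℝ → ℝ≥0∞) :
    ∫⁻ u in Icc k (k + 1), h u = ∫⁻ t : I, h (k + t) := by
  have himg : Icc k (k + 1) = (fun x : ℝ => k + x) '' Icc (0 : ℝ) 1 := by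
    rw [image_const_add_Icc, add_zero]
  rw [himg, lintegral_image_eq_lintegral_abs_deriv_mul (f' := fun _ => 1) measurableSet_Icc
    (fun x _ => by simpa using ((hasDerivAt_id x).const_add k).hasDerivWithinAt)
    (add_right_injective k).injOn, ← lintegral_subtype_comap measurableSet_Icc]
  simp only [abs_one, ENNReal.ofReal_one, one_mul]
  rfl

namespace HyperbolicFilling

variable {Z : Type*} [MetricSpace Z] {α τ : ℝ} (F : HyperbolicFilling Z α τ)

/-! ### Energies of edges -/

/-- The edges of the filling, with an orientation. -/
abbrev Edge : Type _ := {e : F.Vertex × F.Vertex // F.graph.Adj e.1 e.2}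

/-- The `p`-energy of `g` on an edge, with weight `α ^ (-β h)`. -/
noncomputable def edgeEnergy (p β : ℝ) (g : F.Closure → ℝ≥0∞) (e : F.Edge) : ℝ≥0∞ :=
  ∫⁻ t : I, ENNReal.ofReal (α ^ (-β * F.height (edgePoint e.2 t)))
    * g (F.toUniformized (edgePoint e.2 t) : F.Closure) ^ p

/-- The total energy of the edges which start at a vertex `v` of height `k` with `x ∈ B(v)`. -/
noncomputable def levelEnergy (p β : ℝ) (g : F.Closure → ℝ≥0∞) (k : ℤ) (x : Z) : ℝ≥0∞ :=
  ∑' e : F.Edge, {y | e.1.1.height = k ∧ y ∈ e.1.1.ball}.indicator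
    (fun _ => F.edgeEnergy p β g e) x

/-- The sum of the energies of the levels `n, n + 1, …` with geometrically decreasing weights. -/
noncomputable def tailEnergy (p θ : ℝ) (g : F.Closure → ℝ≥0∞) (n : ℤ) (x : Z) : ℝ≥0∞ :=
  ∑' j : ℕ, ENNReal.ofReal (α ^ (-θ * j)) * F.levelEnergy p (p * (1 - θ)) g (n + j) x

variable {F}

lemma edgeEnergy_le_levelEnergy (p β : ℝ) (g : F.Closure → ℝ≥0∞) (e : F.Edge) {k : ℤ} {x : Z}
    (hk : e.1.1.height = k) (hx : x ∈ e.1.1.ball) :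
    F.edgeEnergy p β g e ≤ F.levelEnergy p β g k x := by
  refine le_trans ?_ (ENNReal.le_tsum e)
  rw [indicator_of_mem]
  exact ⟨hk, hx⟩

lemma mem_ball_anchor (z : Z) (k : ℤ) : z ∈ (F.anchor z k).ball :=
  mem_ball_of_dist_lt (by rw [height_anchor]; exact F.dist_anchor z k)

lemma continuous_rayClosure (z : Z) : Continuous (F.rayClosure z) := by
  have hc : Continuous F.tailLength :=
    continuous_iff_continuousAt.2 fun u => (hasDerivAt_tailLength u).continuousAt
  rw [Metric.continuous_iff']
  intro t ε hε
  filter_upwards [Metric.continuous_iff'.1 hc t ε hε] with s hs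
  refine lt_of_le_of_lt ?_ hs
  rcases le_total s t with h | h
  · exact (dist_rayClosure_le z h).trans (le_abs_self _)
  · rw [dist_comm, dist_comm (F.tailLength s)]
    exact (dist_rayClosure_le z h).trans (le_abs_self _)

lemma setLIntegral_rayClosure_le (p β : ℝ) (g : F.Closure → ℝ≥0∞) (z : Z) (k : ℤ) :
    ∫⁻ u in Icc (k : ℝ) (k + 1), ENNReal.ofReal (α ^ (-β * u)) * g (F.rayClosure z u) ^ p
      ≤ F.levelEnergy p β g k z := by
  refine le_trans (le_of_eq ?_) (edgeEnergy_le_levelEnergy p β g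
    ⟨(F.anchor z k, F.anchor z (k + 1)), F.adj_anchor z k⟩ (F.height_anchor z k)
    (mem_ball_anchor z k))
  rw [setLIntegral_Icc_add_one, edgeEnergy]
  refine lintegral_congr fun t => ?_
  have e : F.ray z (k + t) = edgePoint (F.adj_anchor z k) t := by
    rw [ray_eq z (k := k) (by linarith [t.2.1]) (by linarith [t.2.2])]
    congr 1
    apply Subtype.ext
    exact add_sub_cancel_left _ _
  rw [rayClosure, ← e, height_ray]

lemma lintegral_rayClosure_le {p θ : ℝ} (hθ : 0 < θ) (g : F.Closure → ℝ≥0∞) (z : Z) (n : ℤ) :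
    ∫⁻ u in Ici (n : ℝ), ENNReal.ofReal (α ^ (-θ * u)) *
        (ENNReal.ofReal (α ^ (-(p * (1 - θ)) * u)) * g (F.rayClosure z u) ^ p)
      ≤ ENNReal.ofReal (α ^ (-θ * n)) * F.tailEnergy p θ g n z := by
  have hcov : Ici (n : ℝ) ⊆ ⋃ j : ℕ, Icc ((n : ℝ) + j) ((n : ℝ) + j + 1) := by
    intro u hu
    have hu' : (n : ℝ) ≤ u := hu
    refine mem_iUnion.2 ⟨⌊u - n⌋₊, ?_, ?_⟩
    · linarith [Nat.floor_le (sub_nonneg.2 hu')]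
    · linarith [Nat.lt_floor_add_one (u - n)]
  refine (lintegral_mono_set hcov).trans ((lintegral_iUnion_le _ _).trans ?_)
  rw [tailEnergy, ← ENNReal.tsum_mul_left]
  refine ENNReal.tsum_le_tsum fun j => ?_
  rw [← mul_assoc, ← ENNReal.ofReal_mul (Real.rpow_nonneg F.pos.le _), ← Real.rpow_add F.pos]
  have h := setLIntegral_rayClosure_le p (p * (1 - θ)) g z (n + j)
  push_cast at h
  refine le_trans ?_ (mul_le_mul_right h _)
  rw [← lintegral_const_mul' _ _ ENNReal.ofReal_ne_top]
  refine setLIntegral_mono' measurableSet_Icc fun u hu => ?_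
  gcongr
  · exact F.one_lt.le
  · nlinarith [hu.1]

/-- The constant in the estimate of integrals along vertical curves. -/
noncomputable def verticalConst (α p θ : ℝ) : ℝ := α ^ p * (1 / (θ * Real.log α)) ^ (p - 1)

lemma exists_verticalCurve_rpow_le {p θ : ℝ} (hp : 1 ≤ p) (hθ : 0 < θ)
    {g : F.Closure → ℝ≥0∞} (hg : Measurable g) (z : Z) (n : ℤ) :
    ∃ γ : RectifiableCurve (F.boundaryPoint z) (F.vertexClosure (F.anchor z n)),
      γ.lineIntegral g ^ p ≤ ENNReal.ofReal (verticalConst α p θ) *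
        (ENNReal.ofReal (α ^ (-θ * p * n)) * F.tailEnergy p θ g n z) := by
  obtain ⟨γ, hγ⟩ := exists_verticalCurve z n g
  refine ⟨γ, ?_⟩
  have hα := F.pos
  have hp0 : 0 ≤ p := by linarith
  have hl : 0 < θ * Real.log α := mul_pos hθ F.log_pos
  have hgm : Measurable fun u => g (F.rayClosure z u) :=
    hg.comp (continuous_rayClosure z).measurable
  have hw : ∀ b : ℝ, Measurable fun u : ℝ => ENNReal.ofReal (α ^ (b * u)) := fun b =>
    (Measurable.pow measurable_const (measurable_const.mul measurable_id)).ennreal_ofReal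
  set m := (volume.restrict (Ici (n : ℝ))).withDensity
    fun u => ENNReal.ofReal (α ^ (-θ * u)) with hm
  set c : ℝ → ℝ≥0∞ := fun u => ENNReal.ofReal (α ^ (-(1 - θ) * u)) * g (F.rayClosure z u) with hc
  have hcm : Measurable c := (hw _).mul hgm
  have h1 : γ.lineIntegral g ≤ ENNReal.ofReal α * ∫⁻ u, c u ∂m := by
    refine hγ.trans (le_of_eq ?_)
    rw [hm, lintegral_withDensity_eq_lintegral_mul _ (hw _) hcm,
      ← lintegral_const_mul' _ _ ENNReal.ofReal_ne_top]
    refine lintegral_congr fun u => ?_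
    simp only [hc, Pi.mul_apply]
    rw [← mul_assoc, ← mul_assoc, ← ENNReal.ofReal_mul hα.le, ← ENNReal.ofReal_mul (by positivity),
      mul_assoc, ← Real.rpow_add hα]
    congr 4
    ring
  have h2 : m univ ≤ ENNReal.ofReal (α ^ (-θ * n) / (θ * Real.log α)) := by
    rw [hm, withDensity_apply _ MeasurableSet.univ, Measure.restrict_univ]
    exact setLIntegral_Ici_rpow_neg_le F.one_lt hθ n
  have h3 : ∫⁻ u, c u ^ p ∂m ≤ ENNReal.ofReal (α ^ (-θ * n)) * F.tailEnergy p θ g n z := by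
    refine le_trans (le_of_eq ?_) (lintegral_rayClosure_le hθ g z n)
    rw [hm, lintegral_withDensity_eq_lintegral_mul _ (hw _) (hcm.pow_const p)]
    refine lintegral_congr fun u => ?_
    simp only [hc, Pi.mul_apply]
    rw [ENNReal.mul_rpow_of_nonneg _ _ hp0,
      ENNReal.ofReal_rpow_of_nonneg (Real.rpow_nonneg hα.le _) hp0, ← Real.rpow_mul hα.le]
    congr 4
    ring
  calc γ.lineIntegral g ^ p ≤ (ENNReal.ofReal α * ∫⁻ u, c u ∂m) ^ p :=
        ENNReal.rpow_le_rpow h1 hp0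
    _ = ENNReal.ofReal α ^ p * (∫⁻ u, c u ∂m) ^ p := ENNReal.mul_rpow_of_nonneg _ _ hp0
    _ ≤ ENNReal.ofReal α ^ p * (m univ ^ (p - 1) * ∫⁻ u, c u ^ p ∂m) := by
        gcongr
        exact lintegral_rpow_le_measure_univ_rpow_mul m hp hcm.aemeasurable
    _ ≤ ENNReal.ofReal α ^ p * (ENNReal.ofReal (α ^ (-θ * n) / (θ * Real.log α)) ^ (p - 1)
          * (ENNReal.ofReal (α ^ (-θ * n)) * F.tailEnergy p θ g n z)) := by
        gcongr
    _ = ENNReal.ofReal (verticalConst α p θ) *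
        (ENNReal.ofReal (α ^ (-θ * p * n)) * F.tailEnergy p θ g n z) := by
        rw [ENNReal.ofReal_rpow_of_nonneg hα.le hp0,
          ENNReal.ofReal_rpow_of_nonneg (by positivity) (by linarith)]
        simp only [← mul_assoc]
        congr 1
        rw [← ENNReal.ofReal_mul (by positivity), ← ENNReal.ofReal_mul (by positivity),
          ← ENNReal.ofReal_mul (by unfold verticalConst; positivity)]
        congr 1
        have e : α ^ (-θ * p * n) = (α ^ (-θ * n)) ^ (p - 1) * α ^ (-θ * n) := by
          rw [← Real.rpow_mul hα.le, ← Real.rpow_add hα]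
          congr 1
          ring
        rw [verticalConst, e, div_eq_mul_one_div (α ^ (-θ * n)),
          Real.mul_rpow (by positivity) (by positivity)]
        ring

lemma levelEnergy_le_tailEnergy (p θ : ℝ) (g : F.Closure → ℝ≥0∞) (n : ℤ) (x : Z) :
    F.levelEnergy p (p * (1 - θ)) g n x ≤ F.tailEnergy p θ g n x := by
  refine le_trans (le_of_eq ?_) (ENNReal.le_tsum 0)
  simp

lemma exists_horizontalCurve_rpow_le {p θ : ℝ} (hp : 1 ≤ p)
    {g : F.Closure → ℝ≥0∞} (hg : Measurable g) {x y : Z} {n : ℤ}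
    (hxy : dist x y < α ^ (-(n : ℝ))) :
    ∃ γ : RectifiableCurve (F.vertexClosure (F.anchor x n)) (F.vertexClosure (F.anchor y n)),
      γ.lineIntegral g ^ p
        ≤ ENNReal.ofReal (α ^ (-θ * p * n)) * F.tailEnergy p θ g n x := by
  have hα := F.pos
  have hp0 : 0 < p := by linarith
  rcases F.anchor_eq_or_adj hxy with h | h
  · rw [← h]
    refine ⟨RectifiableCurve.refl _, ?_⟩
    simp [RectifiableCurve.lineIntegral, RectifiableCurve.refl, hp0]
  · obtain ⟨γ, hγ⟩ := exists_horizontalCurve h (F.height_anchor x n) (F.height_anchor y n) g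
    refine ⟨γ, ?_⟩
    have hgm : Measurable fun t : I => g (F.toUniformized (edgePoint h t) : F.Closure) :=
      hg.comp ((UniformSpace.Completion.continuous_coe _).comp
        (continuous_toUniformized.comp (continuous_edgePoint h))).measurable
    have hJ := lintegral_rpow_le_measure_univ_rpow_mul (volume : Measure I) hp hgm.aemeasurable
    rw [measure_univ, ENNReal.one_rpow, one_mul] at hJ
    have he : ENNReal.ofReal (α ^ (-(p * (1 - θ)) * n)) *
        ∫⁻ t : I, g (F.toUniformized (edgePoint h t) : F.Closure) ^ p
        ≤ F.tailEnergy p θ g n x := by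
      refine le_trans (le_of_eq ?_) ((edgeEnergy_le_levelEnergy p (p * (1 - θ)) g
        ⟨(F.anchor x n, F.anchor y n), h⟩ (F.height_anchor x n)
        (mem_ball_anchor x n)).trans (levelEnergy_le_tailEnergy p θ g n x))
      rw [edgeEnergy, ← lintegral_const_mul' _ _ ENNReal.ofReal_ne_top]
      refine lintegral_congr fun t => ?_
      rw [height_edgePoint, height_anchor, height_anchor]
      congr 4
      ring
    calc γ.lineIntegral g ^ p ≤ (ENNReal.ofReal (α ^ (-(n : ℝ)))
          * ∫⁻ t : I, g (F.toUniformized (edgePoint h t) : F.Closure)) ^ p :=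
          ENNReal.rpow_le_rpow hγ hp0.le
      _ ≤ ENNReal.ofReal (α ^ (-(n : ℝ))) ^ p
          * ∫⁻ t : I, g (F.toUniformized (edgePoint h t) : F.Closure) ^ p := by
          rw [ENNReal.mul_rpow_of_nonneg _ _ hp0.le]
          gcongr
      _ = ENNReal.ofReal (α ^ (-θ * p * n)) * (ENNReal.ofReal (α ^ (-(p * (1 - θ)) * n)) *
          ∫⁻ t : I, g (F.toUniformized (edgePoint h t) : F.Closure) ^ p) := by
          rw [← mul_assoc, ENNReal.ofReal_rpow_of_nonneg (Real.rpow_nonneg hα.le _) hp0.le,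
            ← ENNReal.ofReal_mul (Real.rpow_nonneg hα.le _), ← Real.rpow_mul hα.le,
            ← Real.rpow_add hα]
          congr 3
          ring
      _ ≤ _ := by gcongr

/-- The constant in the pointwise estimate. -/
noncomputable def curveConst (α p θ : ℝ) : ℝ≥0∞ :=
  3 ^ p * (ENNReal.ofReal (verticalConst α p θ) + 1)

lemma exists_curve_rpow_le {p θ : ℝ} (hp : 1 ≤ p) (hθ : 0 < θ)
    {g : F.Closure → ℝ≥0∞} (hg : Measurable g) {x y : Z} {n : ℤ}
    (hxy : dist x y < α ^ (-(n : ℝ))) :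
    ∃ γ : RectifiableCurve (F.boundaryPoint x) (F.boundaryPoint y), 0 < γ.length ∧
      γ.lineIntegral g ^ p ≤ curveConst α p θ * (ENNReal.ofReal (α ^ (-θ * p * n)) *
        (F.tailEnergy p θ g n x + F.tailEnergy p θ g n y)) := by
  have hp0 : 0 ≤ p := by linarith
  obtain ⟨γ₁, h1⟩ := exists_verticalCurve_rpow_le hp hθ hg x n
  obtain ⟨γ₂, h2⟩ := exists_horizontalCurve_rpow_le (θ := θ) hp hg hxy
  obtain ⟨γ₃, h3⟩ := exists_verticalCurve_rpow_le hp hθ hg y n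
  refine ⟨(γ₁.trans γ₂).trans γ₃.symm, ?_, ?_⟩
  · have hpos : 0 < γ₁.length := by
      refine pos_iff_ne_zero.2 fun h => boundaryPoint_ne_vertexClosure x (F.anchor x n) ?_
      have h4 := γ₁.target
      rw [h, NNReal.coe_zero, γ₁.source] at h4
      exact h4
    change 0 < γ₁.length + γ₂.length + γ₃.symm.length
    rw [add_assoc]
    exact add_pos_of_pos_of_nonneg hpos zero_le
  · have h4 : ((γ₁.trans γ₂).trans γ₃.symm).lineIntegral g
        ≤ γ₁.lineIntegral g + γ₂.lineIntegral g + γ₃.lineIntegral g := by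
      refine (RectifiableCurve.lineIntegral_trans_le _ _ g).trans ?_
      rw [RectifiableCurve.lineIntegral_symm]
      gcongr
      exact RectifiableCurve.lineIntegral_trans_le _ _ g
    set V := ENNReal.ofReal (verticalConst α p θ)
    set E := ENNReal.ofReal (α ^ (-θ * p * n))
    set A := F.tailEnergy p θ g n x
    set B := F.tailEnergy p θ g n y
    calc _ ≤ (γ₁.lineIntegral g + γ₂.lineIntegral g + γ₃.lineIntegral g) ^ p :=
          ENNReal.rpow_le_rpow h4 hp0
      _ ≤ 3 ^ p * (γ₁.lineIntegral g ^ p + γ₂.lineIntegral g ^ p + γ₃.lineIntegral g ^ p) :=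
          ENNReal.add_add_rpow_le hp0 _ _ _
      _ ≤ 3 ^ p * (V * (E * A) + E * A + V * (E * B)) := by gcongr
      _ ≤ 3 ^ p * (V * (E * A) + E * A + V * (E * B)) + 3 ^ p * (E * B) := le_self_add
      _ = curveConst α p θ * (E * (A + B)) := by
          rw [curveConst]
          ring

end HyperbolicFilling

namespace HyperbolicFilling

variable {Z : Type*} [MetricSpace Z] {α τ : ℝ} {F : HyperbolicFilling Z α τ}

/-! ### Countability of the filling -/

section Countable

variable [MeasurableSpace Z] {ν : Measure Z}

lemma sigmaFinite_of_ball_lt_top (hν : ∀ (z : Z) (r : ℝ), 0 < r → ν (Metric.ball z r) < ⊤) :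
    SigmaFinite ν := by
  rcases isEmpty_or_nonempty Z with h | ⟨⟨z⟩⟩
  · have : ν = 0 := Measure.eq_zero_of_isEmpty ν
    rw [this]
    infer_instance
  · refine ⟨⟨⟨fun n : ℕ => Metric.ball z (n + 1), fun _ => mem_univ _,
      fun n => hν z _ (by positivity), ?_⟩⟩⟩
    refine eq_univ_of_forall fun x => mem_iUnion.2 ?_
    obtain ⟨n, hn⟩ := exists_nat_gt (dist x z)
    exact ⟨n, by rw [Metric.mem_ball]; linarith⟩

variable [BorelSpace Z]

lemma countable_net (F : HyperbolicFilling Z α τ)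
    (hν : ∀ (z : Z) (r : ℝ), 0 < r → 0 < ν (Metric.ball z r) ∧ ν (Metric.ball z r) < ⊤) (n : ℤ) :
    (F.net n).Countable := by
  have : SigmaFinite ν := sigmaFinite_of_ball_lt_top fun z r hr => (hν z r hr).2
  have hr : 0 < α ^ (-n) / 2 := half_pos (F.zpow_pos' _)
  have h := Measure.countable_meas_pos_of_disjoint_iUnion (μ := ν)
    (As := fun x : F.net n => Metric.ball (x : Z) (α ^ (-n) / 2))
    (fun _ => Metric.isOpen_ball.measurableSet) (fun x y hxy => by
      refine Metric.ball_disjoint_ball ?_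
      have := (F.net_maximal n).prop x.2 y.2 (fun h => hxy (Subtype.ext h))
      linarith)
  have huniv : {x : F.net n | 0 < ν (Metric.ball (x : Z) (α ^ (-n) / 2))} = univ :=
    eq_univ_of_forall fun x => (hν x _ hr).1
  rw [huniv] at h
  exact countable_coe_iff.1 (countable_univ_iff.1 h)

lemma countable_vertex (F : HyperbolicFilling Z α τ)
    (hν : ∀ (z : Z) (r : ℝ), 0 < r → 0 < ν (Metric.ball z r) ∧ ν (Metric.ball z r) < ⊤) :
    Countable F.Vertex := by
  have : ∀ n, Countable (F.net n) := fun n => (F.countable_net hν n).to_subtype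
  refine Function.Injective.countable (β := Σ n, F.net n)
    (f := fun v => ⟨v.1.2, v.1.1, v.2⟩) ?_
  rintro ⟨⟨z, n⟩, hz⟩ ⟨⟨w, m⟩, hw⟩ h
  simp only [Sigma.mk.injEq] at h
  obtain ⟨rfl, h⟩ := h
  simp only [heq_eq_eq, Subtype.mk.injEq] at h
  subst h
  rfl

lemma secondCountableTopology (F : HyperbolicFilling Z α τ)
    (hν : ∀ (z : Z) (r : ℝ), 0 < r → 0 < ν (Metric.ball z r) ∧ ν (Metric.ball z r) < ⊤) :
    SecondCountableTopology Z := by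
  have : Countable F.Vertex := F.countable_vertex hν
  have : TopologicalSpace.SeparableSpace Z := by
    refine ⟨⟨range fun v : F.Vertex => v.proj, countable_range _, fun z => ?_⟩⟩
    exact mem_closure_of_tendsto (F.tendsto_proj_anchor z)
      (Eventually.of_forall fun n => mem_range_self _)
  exact UniformSpace.secondCountable_of_separable Z

end Countable

/-! ### Integrals of energies -/

section Energy

lemma measurable_height : Measurable F.height := height_lipschitz.continuous.measurable

lemma measurable_toUniformized : Measurable F.toUniformized := continuous_toUniformized.measurable

lemma measurable_coe_closure : Measurable fun x : F.Uniformized => (x : F.Closure) :=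
  (UniformSpace.Completion.continuous_coe _).measurable

/-- The sum of the weights in the definition of `tailEnergy`. -/
noncomputable def weightSum (α θ : ℝ) : ℝ≥0∞ := ∑' j : ℕ, ENNReal.ofReal (α ^ (-θ * j))

lemma weightSum_ne_top (hα : 1 < α) {θ : ℝ} (hθ : 0 < θ) : weightSum α θ ≠ ⊤ := by
  have hα0 : 0 < α := by linarith
  have e : ∀ j : ℕ, ENNReal.ofReal (α ^ (-θ * j)) = ENNReal.ofReal (α ^ (-θ)) ^ j := fun j => by
    rw [Real.rpow_mul hα0.le, Real.rpow_natCast, ENNReal.ofReal_pow (Real.rpow_nonneg hα0.le _)]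
  have h1 : ENNReal.ofReal (α ^ (-θ)) < 1 := by
    rw [ENNReal.ofReal_lt_one]
    exact Real.rpow_lt_one_of_one_lt_of_neg hα (by linarith)
  simp only [weightSum, e]
  rw [ENNReal.tsum_geometric, ENNReal.inv_ne_top]
  exact (tsub_pos_of_lt h1).ne'

variable [MeasurableSpace Z]

lemma lintegral_uniformizedMeasure (ν : Measure Z) (p β : ℝ) {g : F.Closure → ℝ≥0∞}
    (hg : Measurable g) :
    ∫⁻ x, g (x : F.Closure) ^ p ∂F.uniformizedMeasure ν β
      = ∑' e : F.Edge, (ν e.1.1.ball + ν e.1.2.ball) * F.edgeEnergy p β g e := by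
  have hw : Measurable fun x : F.Point => ENNReal.ofReal (α ^ (-β * F.height x)) :=
    (Measurable.pow measurable_const (measurable_const.mul measurable_height)).ennreal_ofReal
  have hgp : Measurable fun x : F.Uniformized => g (x : F.Closure) ^ p :=
    (hg.comp measurable_coe_closure).pow_const p
  have hgp' : Measurable fun x : F.Point => g (F.toUniformized x : F.Closure) ^ p :=
    hgp.comp measurable_toUniformized
  rw [uniformizedMeasure, lintegral_map hgp measurable_toUniformized,
    lintegral_withDensity_eq_lintegral_mul _ hw hgp', lift, lintegral_sum_measure]
  refine tsum_congr fun e => ?_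
  rw [lintegral_smul_measure, smul_eq_mul, edgeMeasure,
    lintegral_map (hw.mul hgp') (continuous_edgePoint e.2).measurable]
  rfl

variable [BorelSpace Z]

lemma measurableSet_height_ball (k : ℤ) (v : F.Vertex) :
    MeasurableSet {y | v.height = k ∧ y ∈ v.ball} := by
  have : {y | v.height = k ∧ y ∈ v.ball} = {_y | v.height = k} ∩ v.ball := rfl
  rw [this]
  exact (MeasurableSet.const _).inter Metric.isOpen_ball.measurableSet

lemma measurable_levelEnergy [Countable F.Vertex] (p β : ℝ) (g : F.Closure → ℝ≥0∞) (k : ℤ) :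
    Measurable (F.levelEnergy p β g k) :=
  Measurable.tsum fun e =>
    measurable_const.indicator (measurableSet_height_ball k e.1.1)

lemma measurable_tailEnergy [Countable F.Vertex] (p θ : ℝ) (g : F.Closure → ℝ≥0∞) (n : ℤ) :
    Measurable (F.tailEnergy p θ g n) :=
  Measurable.tsum fun _ => (measurable_levelEnergy p _ g _).const_mul _

lemma tsum_lintegral_levelEnergy_le [Countable F.Vertex] (ν : Measure Z) (p β : ℝ)
    {g : F.Closure → ℝ≥0∞} (hg : Measurable g) :
    ∑' k : ℤ, ∫⁻ x, F.levelEnergy p β g k x ∂ν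
      ≤ ∫⁻ x, g (x : F.Closure) ^ p ∂F.uniformizedMeasure ν β := by
  rw [lintegral_uniformizedMeasure ν p β hg]
  have h : ∀ k : ℤ, ∫⁻ x, F.levelEnergy p β g k x ∂ν = ∑' e : F.Edge,
      if k = e.1.1.height then F.edgeEnergy p β g e * ν e.1.1.ball else 0 := by
    intro k
    unfold levelEnergy
    rw [lintegral_tsum fun e : F.Edge => (measurable_const.indicator
      (measurableSet_height_ball k e.1.1)).aemeasurable]
    refine tsum_congr fun e => ?_
    rw [lintegral_indicator_const (measurableSet_height_ball k e.1.1)]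
    split_ifs with hk
    · simp [hk]
    · have : {y | e.1.1.height = k ∧ y ∈ e.1.1.ball} = ∅ :=
        eq_empty_of_forall_notMem fun y hy => hk hy.1.symm
      rw [this, measure_empty, mul_zero]
  simp only [h]
  rw [ENNReal.tsum_comm]
  refine ENNReal.tsum_le_tsum fun e => ?_
  rw [tsum_ite_eq, mul_comm]
  gcongr
  exact le_self_add

lemma tsum_lintegral_tailEnergy_le [Countable F.Vertex] (ν : Measure Z) (p θ : ℝ)
    {g : F.Closure → ℝ≥0∞} (hg : Measurable g) :
    ∑' n : ℤ, ∫⁻ x, F.tailEnergy p θ g n x ∂ν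
      ≤ weightSum α θ * ∫⁻ x, g (x : F.Closure) ^ p ∂F.uniformizedMeasure ν (p * (1 - θ)) := by
  have h : ∀ n : ℤ, ∫⁻ x, F.tailEnergy p θ g n x ∂ν = ∑' j : ℕ,
      ENNReal.ofReal (α ^ (-θ * j)) * ∫⁻ x, F.levelEnergy p (p * (1 - θ)) g (n + j) x ∂ν := by
    intro n
    unfold tailEnergy
    rw [lintegral_tsum fun j => ((measurable_levelEnergy p _ g _).const_mul _).aemeasurable]
    exact tsum_congr fun j => lintegral_const_mul _ (measurable_levelEnergy p _ g _)
  simp only [h]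
  rw [ENNReal.tsum_comm, weightSum, ← ENNReal.tsum_mul_right]
  refine ENNReal.tsum_le_tsum fun j => ?_
  rw [ENNReal.tsum_mul_left]
  gcongr
  refine le_trans (le_of_eq ?_) (tsum_lintegral_levelEnergy_le ν p (p * (1 - θ)) hg)
  exact (Equiv.addRight (j : ℤ)).tsum_eq
    fun k => ∫⁻ x, F.levelEnergy p (p * (1 - θ)) g k x ∂ν

end Energy

end HyperbolicFilling

/-! ### The triangle inequality for extended reals -/

lemma EReal.ne_top_ne_bot_of_abs_sub_lt_top {a b : EReal} (h : (a - b).abs < ⊤) :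
    a ≠ ⊤ ∧ a ≠ ⊥ := by
  induction a using EReal.rec <;> induction b using EReal.rec <;> simp_all

lemma EReal.abs_sub_self_eq_zero {a : EReal} (h : a ≠ ⊤ ∧ a ≠ ⊥) : (a - a).abs = 0 := by
  rw [EReal.sub_self h.1 h.2, EReal.abs_zero]

lemma EReal.abs_le_abs_add_abs_sub {a b : EReal} (ha : a ≠ ⊤ ∧ a ≠ ⊥) (hb : b ≠ ⊤ ∧ b ≠ ⊥) :
    a.abs ≤ b.abs + (a - b).abs := by
  lift a to ℝ using ha
  lift b to ℝ using hb
  rw [← EReal.coe_sub, EReal.abs_def, EReal.abs_def, EReal.abs_def,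
    ← ENNReal.ofReal_add (abs_nonneg _) (abs_nonneg _)]
  refine ENNReal.ofReal_le_ofReal ?_
  have := abs_add_le b (a - b)
  rwa [add_sub_cancel] at this

/-- Iterated doubling. -/
lemma measure_ball_two_pow_mul_le {Z : Type*} [MetricSpace Z] [MeasurableSpace Z] {ν : Measure Z}
    {C : ℝ≥0} (hν : ∀ (z : Z) (r : ℝ), 0 < r →
      ν (Metric.ball z (2 * r)) ≤ C * ν (Metric.ball z r)) (m : ℕ) (z : Z) {r : ℝ} (hr : 0 < r) :
    ν (Metric.ball z (2 ^ m * r)) ≤ (C : ℝ≥0∞) ^ m * ν (Metric.ball z r) := by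
  induction m with
  | zero => simp
  | succ m ih =>
    rw [pow_succ', mul_assoc, pow_succ', mul_assoc]
    refine (hν z _ (by positivity)).trans ?_
    gcongr

namespace HyperbolicFilling

variable {Z : Type*} [MetricSpace Z] [MeasurableSpace Z] {α τ : ℝ}
  {F : HyperbolicFilling Z α τ}

/-- The pointwise estimate of a function by the energies of its hyperbolic upper gradient. -/
lemma IsHyperbolicUpperGradient.exists_pointwise {ν : Measure Z} {f : Z → EReal}
    {g : F.Closure → ℝ≥0∞} (h : F.IsHyperbolicUpperGradient ν f g) {p θ : ℝ} (hp : 1 ≤ p)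
    (hθ : 0 < θ) :
    ∃ G : Set Z, ν Gᶜ = 0 ∧ ∀ x ∈ G, ∀ y ∈ G, ∀ n : ℤ, dist x y < α ^ (-(n : ℝ)) →
      (f x - f y).abs ^ p ≤ curveConst α p θ * (ENNReal.ofReal (α ^ (-θ * p * n)) *
        (F.tailEnergy p θ g n x + F.tailEnergy p θ g n y)) := by
  obtain ⟨hg, G, hG, hfg⟩ := h
  refine ⟨G, hG, fun x hx y hy n hn => ?_⟩
  obtain ⟨γ, h1, h2⟩ := exists_curve_rpow_le hp hθ hg hn
  exact (ENNReal.rpow_le_rpow (hfg x hx y hy γ h1) (by linarith)).trans h2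

lemma curveConst_ne_top (α p θ : ℝ) (hp : 0 ≤ p) : curveConst α p θ ≠ ⊤ :=
  ENNReal.mul_ne_top (ENNReal.rpow_ne_top_of_nonneg hp (by simp))
    (ENNReal.add_ne_top.2 ⟨ENNReal.ofReal_ne_top, by simp⟩)

section Besov

variable [BorelSpace Z]

/-- The majorant of the Besov integrand at scale `n`. -/
noncomputable def scaleKernel (F : HyperbolicFilling Z α τ) (ν : Measure Z) (p θ : ℝ)
    (g : F.Closure → ℝ≥0∞) (n : ℤ) (x y : Z) : ℝ≥0∞ :=
  {q : Z × Z | dist q.1 q.2 < α ^ (-(n : ℝ))}.indicator (fun q =>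
    F.tailEnergy p θ g n q.1 / ν (Metric.ball q.1 (α ^ (-(n : ℝ))))
      + F.tailEnergy p θ g n q.2 / ν (Metric.ball q.2 (α ^ (-(n : ℝ))))) (x, y)

lemma measurable_measure_ball [SecondCountableTopology Z] (ν : Measure Z) [SFinite ν] (r : ℝ) :
    Measurable fun x => ν (Metric.ball x r) := by
  have hs : MeasurableSet {q : Z × Z | dist q.2 q.1 < r} :=
    measurableSet_lt (measurable_snd.dist measurable_fst) measurable_const
  exact measurable_measure_prodMk_left hs

variable [SecondCountableTopology Z] [Countable F.Vertex]

lemma measurable_tailEnergy_div (ν : Measure Z) [SFinite ν] (p θ : ℝ)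
    (g : F.Closure → ℝ≥0∞) (n : ℤ) :
    Measurable fun x => F.tailEnergy p θ g n x / ν (Metric.ball x (α ^ (-(n : ℝ)))) :=
  (measurable_tailEnergy p θ g n).div (measurable_measure_ball ν _)

lemma measurable_scaleKernel (ν : Measure Z) [SFinite ν] (p θ : ℝ)
    (g : F.Closure → ℝ≥0∞) (n : ℤ) :
    Measurable fun q : Z × Z => F.scaleKernel ν p θ g n q.1 q.2 := by
  have h := measurable_tailEnergy_div (F := F) ν p θ g n
  exact ((h.comp measurable_fst).add (h.comp measurable_snd)).indicator
    (measurableSet_lt (measurable_fst.dist measurable_snd) measurable_const)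

lemma lintegral_scaleKernel {ν : Measure Z} [SFinite ν]
    (hν : ∀ (z : Z) (r : ℝ), 0 < r → 0 < ν (Metric.ball z r) ∧ ν (Metric.ball z r) < ⊤)
    (p θ : ℝ) (g : F.Closure → ℝ≥0∞) (n : ℤ) :
    ∫⁻ y, ∫⁻ x, F.scaleKernel ν p θ g n x y ∂ν ∂ν = 2 * ∫⁻ x, F.tailEnergy p θ g n x ∂ν := by
  set r : ℝ := α ^ (-(n : ℝ)) with hr
  have hr0 : 0 < r := Real.rpow_pos_of_pos F.pos _
  set T : Z → ℝ≥0∞ := fun x => F.tailEnergy p θ g n x / ν (Metric.ball x r) with hT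
  have hTm : Measurable T := measurable_tailEnergy_div ν p θ g n
  have hset : MeasurableSet {q : Z × Z | dist q.1 q.2 < r} :=
    measurableSet_lt (measurable_fst.dist measurable_snd) measurable_const
  have hcancel : ∀ x, T x * ν (Metric.ball x r) = F.tailEnergy p θ g n x := fun x =>
    ENNReal.div_mul_cancel (hν x r hr0).1.ne' (hν x r hr0).2.ne
  have hsplit : ∀ x y, F.scaleKernel ν p θ g n x y
      = (Metric.ball x r).indicator (fun _ => T x) y
        + (Metric.ball y r).indicator (fun _ => T y) x := by
    intro x y
    by_cases h : dist x y < r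
    · rw [scaleKernel, indicator_of_mem (by exact h),
        indicator_of_mem (by rw [Metric.mem_ball, dist_comm]; exact h),
        indicator_of_mem (by rw [Metric.mem_ball]; exact h)]
    · rw [scaleKernel, indicator_of_notMem (by exact h),
        indicator_of_notMem (by rw [Metric.mem_ball, dist_comm]; exact h),
        indicator_of_notMem (by rw [Metric.mem_ball]; exact h), add_zero]
  have hm1 : Measurable fun q : Z × Z => (Metric.ball q.1 r).indicator (fun _ => T q.1) q.2 := by
    convert (hTm.comp measurable_fst).indicator hset using 1
    ext q
    simp only [indicator, Metric.mem_ball, mem_ofPred_eq, dist_comm q.2, Function.comp_apply]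
  have hind : ∀ x, ∫⁻ y, (Metric.ball x r).indicator (fun _ => T x) y ∂ν
      = F.tailEnergy p θ g n x := fun x => by
    rw [lintegral_indicator_const Metric.isOpen_ball.measurableSet, hcancel]
  calc ∫⁻ y, ∫⁻ x, F.scaleKernel ν p θ g n x y ∂ν ∂ν
      = ∫⁻ y, ((∫⁻ x, (Metric.ball x r).indicator (fun _ => T x) y ∂ν)
          + F.tailEnergy p θ g n y) ∂ν := by
        refine lintegral_congr fun y => ?_
        simp only [hsplit]
        rw [lintegral_add_right _ (measurable_const.indicator Metric.isOpen_ball.measurableSet),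
          hind]
    _ = 2 * ∫⁻ x, F.tailEnergy p θ g n x ∂ν := by
        rw [lintegral_add_right _ (measurable_tailEnergy p θ g n),
          lintegral_lintegral_swap (f := fun y x => (Metric.ball x r).indicator (fun _ => T x) y)
            (hm1.comp measurable_swap).aemeasurable]
        simp only [hind]
        rw [two_mul]

end Besov

/-- The constant in the estimate of the Besov integrand. -/
noncomputable def kernelConst (α p θ : ℝ) (Cν : ℝ≥0) (c : ℝ) (m : ℕ) : ℝ≥0∞ :=
  curveConst α p θ * (ENNReal.ofReal ((c / α) ^ (p * θ)))⁻¹ * (Cν : ℝ≥0∞) ^ m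

lemma kernelConst_ne_top {α p θ c : ℝ} (hα : 0 < α) (hp : 0 ≤ p) (hc : 0 < c) (Cν : ℝ≥0) (m : ℕ) :
    kernelConst α p θ Cν c m ≠ ⊤ := by
  refine ENNReal.mul_ne_top (ENNReal.mul_ne_top (curveConst_ne_top α p θ hp) ?_)
    (ENNReal.pow_ne_top ENNReal.coe_ne_top)
  rw [ENNReal.inv_ne_top]
  simpa using Real.rpow_pos_of_pos (div_pos hc hα) _

lemma exists_besov_integrand_le {ν : Measure Z}
    (hν : ∀ (z : Z) (r : ℝ), 0 < r → 0 < ν (Metric.ball z r) ∧ ν (Metric.ball z r) < ⊤)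
    {Cν : ℝ≥0} (hCν : ∀ (z : Z) (r : ℝ), 0 < r →
      ν (Metric.ball z (2 * r)) ≤ Cν * ν (Metric.ball z r))
    {p θ : ℝ} (hp : 1 ≤ p) (hθ : 0 < θ) {g : F.Closure → ℝ≥0∞}
    {D : Z → Z → ℝ} {c₁ c₂ : ℝ} (hc₁ : 0 < c₁) (hc₂ : 0 < c₂)
    (hD₁ : ∀ x y, c₁ * dist x y ≤ D x y) (hD₂ : ∀ x y, D x y ≤ c₂ * dist x y)
    {m : ℕ} (hm : 2 * (c₂ * α / c₁) ≤ 2 ^ m) {x y : Z} (hxy : x ≠ y) {P : ℝ≥0∞}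
    (hP : ∀ n : ℤ, dist x y < α ^ (-(n : ℝ)) →
      P ≤ curveConst α p θ * (ENNReal.ofReal (α ^ (-θ * p * n)) *
        (F.tailEnergy p θ g n x + F.tailEnergy p θ g n y))) :
    ∃ n : ℤ, P / (ENNReal.ofReal (D x y) ^ (p * θ) * ν {z | D x z < D x y})
      ≤ kernelConst α p θ Cν c₁ m * F.scaleKernel ν p θ g n x y := by
  have hα := F.pos
  have hd : 0 < dist x y := dist_pos.2 hxy
  obtain ⟨n, h1, h2⟩ := exists_level F.one_lt hd
  refine ⟨n, ?_⟩
  set r : ℝ := α ^ (-(n : ℝ)) with hr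
  have hr0 : 0 < r := Real.rpow_pos_of_pos hα _
  have hpθ : 0 ≤ p * θ := by positivity
  set W := ν {z | D x z < D x y} with hW
  set q := ENNReal.ofReal ((c₁ / α) ^ (p * θ)) with hq
  set e := ENNReal.ofReal (α ^ (-θ * p * n)) with he
  set Sx := F.tailEnergy p θ g n x
  set Sy := F.tailEnergy p θ g n y
  have hQ : q * e ≤ ENNReal.ofReal (D x y) ^ (p * θ) := by
    have h3 : c₁ / α * r ≤ D x y := by
      refine le_trans ?_ (hD₁ x y)
      rw [div_mul_eq_mul_div, div_le_iff₀ hα, mul_assoc, mul_comm (dist x y)]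
      gcongr
    rw [hq, he, ← ENNReal.ofReal_mul (by positivity),
      ENNReal.ofReal_rpow_of_nonneg ((by positivity : 0 ≤ c₁ / α * r).trans h3) hpθ]
    refine ENNReal.ofReal_le_ofReal ?_
    calc (c₁ / α) ^ (p * θ) * α ^ (-θ * p * n) = (c₁ / α * r) ^ (p * θ) := by
          rw [Real.mul_rpow (by positivity) hr0.le, hr, ← Real.rpow_mul hα.le]
          congr 2
          ring
      _ ≤ _ := Real.rpow_le_rpow (by positivity) h3 hpθ
  have hball : ν (Metric.ball x (2 * r)) ≤ (Cν : ℝ≥0∞) ^ m * W := by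
    set s : ℝ := c₁ / c₂ * dist x y with hs
    have hs0 : 0 < s := by positivity
    have h3 : 2 * r ≤ 2 ^ m * s := by
      calc 2 * r ≤ 2 * (α * dist x y) := by gcongr
        _ = 2 * (c₂ * α / c₁) * s := by
            rw [hs]
            field_simp
        _ ≤ 2 ^ m * s := by gcongr
    refine (measure_mono (Metric.ball_subset_ball h3)).trans
      ((measure_ball_two_pow_mul_le hCν m x hs0).trans ?_)
    refine mul_le_mul_right (measure_mono fun z hz => ?_) _
    rw [Metric.mem_ball, dist_comm] at hz
    refine lt_of_le_of_lt (hD₂ x z) (lt_of_lt_of_le ?_ (hD₁ x y))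
    calc c₂ * dist x z < c₂ * s := by gcongr
      _ = c₁ * dist x y := by
          rw [hs]
          field_simp
  have hx : Sx ≤ Sx / ν (Metric.ball x r) * ((Cν : ℝ≥0∞) ^ m * W) := by
    calc Sx = Sx / ν (Metric.ball x r) * ν (Metric.ball x r) :=
          (ENNReal.div_mul_cancel (hν x r hr0).1.ne' (hν x r hr0).2.ne).symm
      _ ≤ _ := by
          gcongr
          exact (measure_mono (Metric.ball_subset_ball (by linarith))).trans hball
  have hy : Sy ≤ Sy / ν (Metric.ball y r) * ((Cν : ℝ≥0∞) ^ m * W) := by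
    calc Sy = Sy / ν (Metric.ball y r) * ν (Metric.ball y r) :=
          (ENNReal.div_mul_cancel (hν y r hr0).1.ne' (hν y r hr0).2.ne).symm
      _ ≤ _ := by
          gcongr
          refine (measure_mono (Metric.ball_subset_ball' ?_)).trans hball
          rw [dist_comm]
          linarith
  have hq0 : q ≠ 0 := by simpa [hq] using Real.rpow_pos_of_pos (div_pos hc₁ hα) _
  have hker : F.scaleKernel ν p θ g n x y
      = Sx / ν (Metric.ball x r) + Sy / ν (Metric.ball y r) := indicator_of_mem (by exact h2) _
  rw [hker]
  refine ENNReal.div_le_of_le_mul ?_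
  calc P ≤ curveConst α p θ * (e * (Sx + Sy)) := hP n h2
    _ ≤ curveConst α p θ * (e * (Sx / ν (Metric.ball x r) * ((Cν : ℝ≥0∞) ^ m * W)
          + Sy / ν (Metric.ball y r) * ((Cν : ℝ≥0∞) ^ m * W))) := by gcongr
    _ = curveConst α p θ * (q⁻¹ * q) * (Cν : ℝ≥0∞) ^ m
          * (Sx / ν (Metric.ball x r) + Sy / ν (Metric.ball y r)) * (e * W) := by
        rw [ENNReal.inv_mul_cancel hq0 ENNReal.ofReal_ne_top]
        ring
    _ = kernelConst α p θ Cν c₁ m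
          * (Sx / ν (Metric.ball x r) + Sy / ν (Metric.ball y r)) * (q * e * W) := by
        rw [kernelConst]
        ring
    _ ≤ _ := by gcongr

section Membership

variable [BorelSpace Z] {ν : Measure Z}
  (hν : ∀ (z : Z) (r : ℝ), 0 < r → 0 < ν (Metric.ball z r) ∧ ν (Metric.ball z r) < ⊤)
  {p θ : ℝ} (hp : 1 ≤ p) (hθ : 0 < θ) {f : Z → EReal} {g : F.Closure → ℝ≥0∞}
  (hfg : F.IsHyperbolicUpperGradient ν f g)
  (hgp : ∫⁻ x, g (x : F.Closure) ^ p ∂F.uniformizedMeasure ν (p * (1 - θ)) < ⊤)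

include hν hθ hfg hgp

lemma lintegral_tailEnergy_lt_top (n : ℤ) : ∫⁻ x, F.tailEnergy p θ g n x ∂ν < ⊤ := by
  have := F.countable_vertex hν
  refine lt_of_le_of_lt (ENNReal.le_tsum n) (lt_of_le_of_lt
    (tsum_lintegral_tailEnergy_le ν p θ hfg.1) ?_)
  exact ENNReal.mul_lt_top (weightSum_ne_top F.one_lt hθ).lt_top hgp

include hp

/-- Almost every point is good: `f` is finite there and the pointwise estimate holds. -/
lemma exists_ae_pointwise :
    ∃ G : Set Z, (∀ᵐ x ∂ν, x ∈ G) ∧ (∀ x ∈ G, f x ≠ ⊤ ∧ f x ≠ ⊥) ∧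
      ∀ x ∈ G, ∀ y ∈ G, ∀ n : ℤ, dist x y < α ^ (-(n : ℝ)) →
      (f x - f y).abs ^ p ≤ curveConst α p θ * (ENNReal.ofReal (α ^ (-θ * p * n)) *
        (F.tailEnergy p θ g n x + F.tailEnergy p θ g n y)) := by
  have := F.countable_vertex hν
  have hp0 : 0 < p := by linarith
  obtain ⟨G, hG, h⟩ := hfg.exists_pointwise hp hθ
  have hS := ae_lt_top (measurable_tailEnergy p θ g 0)
    (lintegral_tailEnergy_lt_top hν hθ hfg hgp 0).ne
  refine ⟨G ∩ {x | F.tailEnergy p θ g 0 x < ⊤}, ?_, ?_, fun x hx y hy => h x hx.1 y hy.1⟩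
  · filter_upwards [measure_eq_zero_iff_ae_notMem.1 hG, hS] with x h1 h2
    exact ⟨not_not.1 h1, h2⟩
  · rintro x ⟨hx, hS⟩
    have h0 := h x hx x hx 0 (by rw [dist_self]; exact Real.rpow_pos_of_pos F.pos _)
    have h1 : (f x - f x).abs ^ p < ⊤ := by
      refine lt_of_le_of_lt h0 ?_
      exact ENNReal.mul_lt_top (curveConst_ne_top α p θ hp0.le).lt_top
        (ENNReal.mul_lt_top ENNReal.ofReal_lt_top (ENNReal.add_lt_top.2 ⟨hS, hS⟩))
    exact EReal.ne_top_ne_bot_of_abs_sub_lt_top ((ENNReal.rpow_lt_top_iff_of_pos hp0).1 h1)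

lemma lintegral_ball_abs_rpow_lt_top (z : Z) (r : ℝ) :
    ∫⁻ x in Metric.ball z r, (f x).abs ^ p ∂ν < ⊤ := by
  have := F.countable_vertex hν
  have hp0 : 0 ≤ p := by linarith
  rcases le_or_gt r 0 with hr | hr
  · rw [Metric.ball_eq_empty.2 hr]
    simp
  obtain ⟨G, hG, hfin, hpt⟩ := exists_ae_pointwise hν hp hθ hfg hgp
  obtain ⟨N, hN⟩ := pow_unbounded_of_one_lt (2 * r) F.one_lt
  set n : ℤ := -(N : ℤ) with hn
  have hn' : α ^ (-(n : ℝ)) = α ^ N := by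
    rw [hn]
    push_cast
    rw [neg_neg, Real.rpow_natCast]
  have hSn := lintegral_tailEnergy_lt_top hν hθ hfg hgp n
  have hS := ae_lt_top (measurable_tailEnergy p θ g n) hSn.ne
  have hB := (hν z r hr)
  obtain ⟨y, ⟨hyG, hyS⟩, hyB⟩ : ∃ y, (y ∈ G ∧ F.tailEnergy p θ g n y < ⊤) ∧
      y ∈ Metric.ball z r := by
    by_contra! hcon
    refine hB.1.ne' (measure_eq_zero_iff_ae_notMem.2 ?_)
    filter_upwards [hG, hS] with x h1 h2
    exact hcon x ⟨h1, h2⟩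
  set K := curveConst α p θ * ENNReal.ofReal (α ^ (-θ * p * n)) with hK
  have hKtop : K < ⊤ := ENNReal.mul_lt_top (curveConst_ne_top α p θ hp0).lt_top
    ENNReal.ofReal_lt_top
  have hfy : (f y).abs ^ p < ⊤ := by
    refine ENNReal.rpow_lt_top_of_nonneg hp0 ?_
    have h := hfin y hyG
    lift f y to ℝ using h with t
    rw [EReal.abs_def]
    exact ENNReal.ofReal_ne_top
  have hle : ∀ᵐ x ∂ν.restrict (Metric.ball z r), (f x).abs ^ p
      ≤ 3 ^ p * ((f y).abs ^ p + K * F.tailEnergy p θ g n y)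
        + 3 ^ p * K * F.tailEnergy p θ g n x := by
    filter_upwards [ae_restrict_of_ae hG, ae_restrict_mem Metric.isOpen_ball.measurableSet]
      with x hx hxB
    have hd : dist x y < α ^ (-(n : ℝ)) := by
      rw [hn']
      rw [Metric.mem_ball] at hxB hyB
      linarith [dist_triangle_right x y z]
    calc (f x).abs ^ p ≤ ((f y).abs + (f x - f y).abs + 0) ^ p := by
          rw [add_zero]
          exact ENNReal.rpow_le_rpow (EReal.abs_le_abs_add_abs_sub (hfin x hx) (hfin y hyG)) hp0
      _ ≤ 3 ^ p * ((f y).abs ^ p + (f x - f y).abs ^ p + 0 ^ p) :=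
          ENNReal.add_add_rpow_le hp0 _ _ _
      _ = 3 ^ p * ((f y).abs ^ p + (f x - f y).abs ^ p) := by
          rw [ENNReal.zero_rpow_of_pos (by linarith), add_zero]
      _ ≤ 3 ^ p * ((f y).abs ^ p
            + K * (F.tailEnergy p θ g n x + F.tailEnergy p θ g n y)) := by
          gcongr
          refine (hpt x hx y hyG n hd).trans (le_of_eq ?_)
          rw [hK, mul_assoc (curveConst α p θ)]
      _ = _ := by ring
  have h3 : (3 : ℝ≥0∞) ^ p < ⊤ := ENNReal.rpow_lt_top_of_nonneg hp0 (by simp)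
  refine lt_of_le_of_lt (lintegral_mono_ae hle) ?_
  rw [lintegral_add_left measurable_const, setLIntegral_const,
    lintegral_const_mul _ (measurable_tailEnergy p θ g n)]
  refine ENNReal.add_lt_top.2 ⟨ENNReal.mul_lt_top (ENNReal.mul_lt_top h3 (ENNReal.add_lt_top.2
    ⟨hfy, ENNReal.mul_lt_top hKtop hyS⟩)) hB.2, ENNReal.mul_lt_top (ENNReal.mul_lt_top h3 hKtop)
    (lt_of_le_of_lt (setLIntegral_le_lintegral _ _) hSn)⟩

lemma besov_lintegral_le {Cν : ℝ≥0} (hCν : ∀ (z : Z) (r : ℝ), 0 < r →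
      ν (Metric.ball z (2 * r)) ≤ Cν * ν (Metric.ball z r))
    {D : Z → Z → ℝ} {c₁ c₂ : ℝ} (hc₁ : 0 < c₁) (hc₂ : 0 < c₂)
    (hD₁ : ∀ x y, c₁ * dist x y ≤ D x y) (hD₂ : ∀ x y, D x y ≤ c₂ * dist x y)
    {m : ℕ} (hm : 2 * (c₂ * α / c₁) ≤ 2 ^ m) :
    ∫⁻ y, ∫⁻ x, (f x - f y).abs ^ p /
        (ENNReal.ofReal (D x y) ^ (p * θ) * ν {z | D x z < D x y}) ∂ν ∂ν
      ≤ kernelConst α p θ Cν c₁ m * (2 * weightSum α θ) *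
        ∫⁻ x, g (x : F.Closure) ^ p ∂F.uniformizedMeasure ν (p * (1 - θ)) := by
  have := F.countable_vertex hν
  have := F.secondCountableTopology hν
  have : SigmaFinite ν := sigmaFinite_of_ball_lt_top fun z r hr => (hν z r hr).2
  have hp0 : 0 < p := by linarith
  obtain ⟨G, hG, hfin, hpt⟩ := exists_ae_pointwise hν hp hθ hfg hgp
  set K := kernelConst α p θ Cν c₁ m with hK
  have hle : ∀ x ∈ G, ∀ y ∈ G, (f x - f y).abs ^ p /
      (ENNReal.ofReal (D x y) ^ (p * θ) * ν {z | D x z < D x y})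
      ≤ ∑' n : ℤ, K * F.scaleKernel ν p θ g n x y := by
    intro x hx y hy
    rcases eq_or_ne x y with rfl | hxy
    · rw [EReal.abs_sub_self_eq_zero (hfin x hx), ENNReal.zero_rpow_of_pos hp0,
        ENNReal.zero_div]
      exact zero_le
    · obtain ⟨n, hn⟩ := exists_besov_integrand_le hν hCν hp hθ hc₁ hc₂ hD₁ hD₂ hm hxy
        (hpt x hx y hy)
      exact hn.trans (ENNReal.le_tsum (f := fun n => K * F.scaleKernel ν p θ g n x y) n)
  have hmeas : ∀ n, Measurable fun q : Z × Z => K * F.scaleKernel ν p θ g n q.1 q.2 := fun n =>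
    (measurable_scaleKernel ν p θ g n).const_mul K
  calc _ ≤ ∫⁻ y, ∫⁻ x, ∑' n : ℤ, K * F.scaleKernel ν p θ g n x y ∂ν ∂ν := by
        refine lintegral_mono_ae ?_
        filter_upwards [hG] with y hy
        refine lintegral_mono_ae ?_
        filter_upwards [hG] with x hx
        exact hle x hx y hy
    _ = ∑' n : ℤ, ∫⁻ y, ∫⁻ x, K * F.scaleKernel ν p θ g n x y ∂ν ∂ν := by
        rw [← lintegral_tsum fun n => ((hmeas n).lintegral_prod_left').aemeasurable]
        refine lintegral_congr fun y => ?_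
        exact lintegral_tsum fun n => ((hmeas n).comp measurable_prodMk_right).aemeasurable
    _ = ∑' n : ℤ, K * (2 * ∫⁻ x, F.tailEnergy p θ g n x ∂ν) := by
        refine tsum_congr fun n => ?_
        rw [← lintegral_scaleKernel hν, ← lintegral_const_mul _
          (measurable_scaleKernel ν p θ g n).lintegral_prod_left']
        refine lintegral_congr fun y => ?_
        exact lintegral_const_mul _
          ((measurable_scaleKernel ν p θ g n).comp measurable_prodMk_right)
    _ = K * 2 * ∑' n : ℤ, ∫⁻ x, F.tailEnergy p θ g n x ∂ν := by
        rw [← ENNReal.tsum_mul_left]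
        simp only [mul_assoc]
    _ ≤ K * 2 * (weightSum α θ *
          ∫⁻ x, g (x : F.Closure) ^ p ∂F.uniformizedMeasure ν (p * (1 - θ))) := by
        gcongr
        exact tsum_lintegral_tailEnergy_le ν p θ hfg.1
    _ = _ := by ring

lemma memBesov_and_besovNorm_le {Cν : ℝ≥0} (hCν : ∀ (z : Z) (r : ℝ), 0 < r →
      ν (Metric.ball z (2 * r)) ≤ Cν * ν (Metric.ball z r)) (hf : AEMeasurable f ν)
    {D : Z → Z → ℝ} {c₁ c₂ : ℝ} (hc₁ : 0 < c₁) (hc₂ : 0 < c₂)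
    (hD₁ : ∀ x y, c₁ * dist x y ≤ D x y) (hD₂ : ∀ x y, D x y ≤ c₂ * dist x y)
    {m : ℕ} (hm : 2 * (c₂ * α / c₁) ≤ 2 ^ m) :
    MemBesov D ν θ p f ∧ besovNorm D ν θ p f
      ≤ (kernelConst α p θ Cν c₁ m * (2 * weightSum α θ)) ^ (1 / p) *
        lpSeminorm (F.uniformizedMeasure ν (p * (1 - θ))) p (fun x => g (x : F.Closure)) := by
  have hp0 : 0 < p := by linarith
  have h1p : 0 ≤ 1 / p := by positivity
  have hle : besovNorm D ν θ p f
      ≤ (kernelConst α p θ Cν c₁ m * (2 * weightSum α θ)) ^ (1 / p) *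
        lpSeminorm (F.uniformizedMeasure ν (p * (1 - θ))) p (fun x => g (x : F.Closure)) := by
    rw [lpSeminorm, ← ENNReal.mul_rpow_of_nonneg _ _ h1p]
    exact ENNReal.rpow_le_rpow
      (besov_lintegral_le hν hp hθ hfg hgp hCν hc₁ hc₂ hD₁ hD₂ hm) h1p
  refine ⟨⟨hf, fun z r => ?_, lt_of_le_of_lt hle ?_⟩, hle⟩
  · refine lt_of_le_of_lt (lintegral_mono_set ?_)
      (lintegral_ball_abs_rpow_lt_top hν hp hθ hfg hgp z (r / c₁))
    intro x hx
    rw [Metric.mem_ball, dist_comm, lt_div_iff₀ hc₁, mul_comm]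
    exact (hD₁ z x).trans_lt hx
  · refine ENNReal.mul_lt_top (ENNReal.rpow_lt_top_of_nonneg h1p ?_)
      (ENNReal.rpow_lt_top_of_nonneg h1p hgp.ne)
    exact ENNReal.mul_ne_top (kernelConst_ne_top F.pos hp0.le hc₁ _ _)
      (ENNReal.mul_ne_top (by simp) (weightSum_ne_top F.one_lt hθ))

end Membership

lemma lpSeminorm_closureMeasure (ν : Measure Z) (β p : ℝ) {g : F.Closure → ℝ≥0∞}
    (hg : Measurable g) :
    lpSeminorm (F.closureMeasure ν β) p g
      = lpSeminorm (F.uniformizedMeasure ν β) p (fun x => g (x : F.Closure)) := by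
  rw [lpSeminorm, lpSeminorm, closureMeasure, lintegral_map (hg.pow_const p) measurable_coe_closure]

end HyperbolicFilling

theorem mainTheorem10 (α τ p θ : ℝ) (Cν : ℝ≥0) (hα : 1 < α) (hτ : max 3 (α / (α - 1)) < τ)
    (hp : 1 ≤ p) (hθ0 : 0 < θ) (hθ1 : θ < 1) :
    ∃ C : ℝ≥0, ∀ (Z : Type*) [MetricSpace Z] [CompleteSpace Z] [MeasurableSpace Z] [BorelSpace Z]
      (ν : Measure Z),
      (∀ (z : Z) (r : ℝ), 0 < r → 0 < ν (Metric.ball z r) ∧ ν (Metric.ball z r) < ⊤) →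
      (∀ (z : Z) (r : ℝ), 0 < r → ν (Metric.ball z (2 * r)) ≤ Cν * ν (Metric.ball z r)) →
      ∀ (F : HyperbolicFilling Z α τ) (f : Z → EReal) (g : F.Closure → ℝ≥0∞),
        AEMeasurable f ν →
        F.IsHyperbolicUpperGradient ν f g →
        lpSeminorm (F.closureMeasure ν (p * (1 - θ))) p g < ⊤ →
        (MemBesov dist ν θ p f ∧
          besovNorm dist ν θ p f
            ≤ C * lpSeminorm (F.uniformizedMeasure ν (p * (1 - θ))) p (fun x => g (x : F.Closure))) ∧
        (MemBesov F.boundaryDist ν θ p f ∧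
          besovNorm F.boundaryDist ν θ p f
            ≤ C * lpSeminorm (F.uniformizedMeasure ν (p * (1 - θ))) p (fun x => g (x : F.Closure))) := by
  have hα0 : 0 < α := by linarith
  have hl : 0 < Real.log α := Real.log_pos hα
  have hτ0 : 0 < τ := by linarith [lt_of_le_of_lt (le_max_left _ _) hτ]
  have hp0 : 0 < p := by linarith
  have hc₁ : 0 < (2 * τ * α ^ 3)⁻¹ := by positivity
  have hc₂ : 0 < (2 * (α / Real.log α) + 1) * α := by positivity
  obtain ⟨m₁, hm₁⟩ := pow_unbounded_of_one_lt (2 * (1 * α / 1)) (one_lt_two (α := ℝ))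
  obtain ⟨m₂, hm₂⟩ := pow_unbounded_of_one_lt
    (2 * ((2 * (α / Real.log α) + 1) * α * α / (2 * τ * α ^ 3)⁻¹)) (one_lt_two (α := ℝ))
  set K₁ := (HyperbolicFilling.kernelConst α p θ Cν 1 m₁ * (2 * HyperbolicFilling.weightSum α θ)) ^ (1 / p) with hK₁
  set K₂ := (HyperbolicFilling.kernelConst α p θ Cν (2 * τ * α ^ 3)⁻¹ m₂ * (2 * HyperbolicFilling.weightSum α θ)) ^ (1 / p) with hK₂
  have htop : ∀ (c : ℝ) (m : ℕ), 0 < c →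
      (HyperbolicFilling.kernelConst α p θ Cν c m * (2 * HyperbolicFilling.weightSum α θ)) ^ (1 / p) ≠ ⊤ := fun c m hc =>
    ENNReal.rpow_ne_top_of_nonneg (by positivity)
      (ENNReal.mul_ne_top (HyperbolicFilling.kernelConst_ne_top hα0 hp0.le hc _ _)
        (ENNReal.mul_ne_top (by simp) (HyperbolicFilling.weightSum_ne_top hα hθ0)))
  have hmax : max K₁ K₂ ≠ ⊤ :=
    (max_lt (htop _ _ one_pos).lt_top (htop _ _ hc₁).lt_top).ne
  refine ⟨(max K₁ K₂).toNNReal, fun Z _ _ _ _ ν hν hCν F f g hf hfg hg => ?_⟩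
  rw [ENNReal.coe_toNNReal hmax]
  have hgp : ∫⁻ x, g (x : F.Closure) ^ p ∂F.uniformizedMeasure ν (p * (1 - θ)) < ⊤ := by
    rw [HyperbolicFilling.lpSeminorm_closureMeasure _ _ _ hfg.1, lpSeminorm] at hg
    exact (ENNReal.rpow_lt_top_iff_of_pos (by positivity)).1 hg
  have h1 := HyperbolicFilling.memBesov_and_besovNorm_le (D := dist) hν hp hθ0 hfg hgp hCν hf one_pos one_pos
    (fun x y => by rw [one_mul]) (fun x y => by rw [one_mul]) hm₁.le
  have h2 := HyperbolicFilling.memBesov_and_besovNorm_le (D := F.boundaryDist) hν hp hθ0 hfg hgp hCν hf hc₁ hc₂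
    (fun x y => (inv_mul_le_iff₀ (by positivity)).2 (F.dist_le_mul_boundaryDist x y))
    (fun x y => F.boundaryDist_le_mul_dist x y) hm₂.le
  refine ⟨⟨h1.1, h1.2.trans ?_⟩, ⟨h2.1, h2.2.trans ?_⟩⟩
  · gcongr
    exact le_max_left _ _
  · gcongr
    exact le_max_right _ _
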